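/- Let $n\ge 2$ and $\alpha\ge 0$. Let $\mathbb P^n=\{z\in\mathbb C^n:|z_i|<1,\ i=1,\dots,n\}$, let $|\cdot|$ be the Euclidean norm, and for a locally biholomorphic $f=(f_1,\dots,f_n):\mathbb P^n\to\mathbb C^n$ with complex Jacobian $J_f=\det Df$ put $$S^k_{ij}f=\sum_{l=1}^n\frac{\partial^2 f_l}{\partial z_i\partial z_j}\frac{\partial z_k}{\partial f_l}-\frac1{n+1}\Big(\delta^k_i\frac{\partial}{\partial z_j}+\delta^k_j\frac{\partial}{\partial z_i}\Big)\log J_f ,\qquad S_f(z)(v)=\Big(\sum_{i,j}S^k_{ij}f(z)\,v_iv_j\Big)_{k=1}^n ,$$ where $(\partial z_k/\partial f_l)_{k,l}=(Df)^{-1}$. Let $\|S_f\|=\sup_{z\in\mathbb P^n}\sup_{\|v\|_z=1}\|S_f(z)(v)\|_z$, where $\|v\|_z=\big(2\sum_i|v_i|^2/(1-|z_i|^2)^2\big)^{1/2}$ is the Bergman norm at $z$. Let $\mathcal F_\alpha$ be the family of all locally biholomorphic $f:\mathbb P^n\to\mathbb C^n$ with $f(0)=0$, $Df(0)=I$ and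 $\|S_f\|\le\alpha$. Let $\mathcal F^0_\alpha$ be the family of all mappings $g=T_a\circ f$ with $f\in\mathcal F_\alpha$ and $$T_a(w)=\frac{w}{1+a_1w_1+\dots+a_nw_n},\qquad a\in\mathbb C^n \text{ such that } \nabla J_g(0)=0;$$ such a $g$ is defined on the set of those $z\in\mathbb P^n$ at which $1+a_1f_1(z)+\dots+a_nf_n(z)\ne0$. Then there is a number $s_0=s_0(n,\alpha)>0$ such that: 1. the order of $\mathcal F_\alpha$ is finite, with $\lambda_\alpha=\sup_{f\in\mathcal F_\alpha}|\nabla J_f(0)|\le\dfrac{n+1}{s_0}$; 2. the image of every $g\in\mathcal F^0_\alpha$ contains the Euclidean ball $\{w\in\mathbb C^n:|w|<s_0\}$; 3. the image $f(\mathbb P^n)$ of every $f\in\mathcal F_\alpha$ contains the Euclidean ball $\{w\in\mathbb C^n:|w|<s_0/2\}$. -/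

import Mathlib

open scoped ENNReal

namespace PolydiskSchwarzian

noncomputable section

/-- Complex `n`-space with the Euclidean norm. -/
abbrev Cn (n : ℕ) : Type := EuclideanSpace ℂ (Fin n)

/-- The open unit polydisk. -/
def polydisk (n : ℕ) : Set (Cn n) := {z | ∀ i, ‖z i‖ < 1}

/-- The complex partial derivative `∂h/∂z_i` at `z`. -/
def pderiv {n : ℕ} (i : Fin n) (h : Cn n → ℂ) (z : Cn n) : ℂ :=
  fderiv ℂ h z (EuclideanSpace.single i 1)

/-- The complex gradient `(∂h/∂z_1, …, ∂h/∂z_n)` at `z`. -/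
def grad {n : ℕ} (h : Cn n → ℂ) (z : Cn n) : Cn n :=
  WithLp.toLp 2 (fun i => pderiv i h z)

/-- The Jacobian matrix of `f` at `z`, with entry `∂f_l/∂z_i` in row `l` and column `i`. -/
def jacMatrix {n : ℕ} (f : Cn n → Cn n) (z : Cn n) : Matrix (Fin n) (Fin n) ℂ :=
  Matrix.of fun l i => pderiv i (fun w => f w l) z

/-- The complex Jacobian (determinant) `J_f`. -/
def jac {n : ℕ} (f : Cn n → Cn n) (z : Cn n) : ℂ := (jacMatrix f z).det

/-- `f` is locally biholomorphic on `U`: near every point of `U` it agrees with a homeomorphism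
between open sets that is holomorphic together with its inverse. -/
def LocallyBiholomorphicOn {n : ℕ} (f : Cn n → Cn n) (U : Set (Cn n)) : Prop :=
  ∀ z ∈ U, ∃ e : OpenPartialHomeomorph (Cn n) (Cn n),
    z ∈ e.source ∧ e.source ⊆ U ∧ Set.EqOn f e e.source ∧
    DifferentiableOn ℂ e e.source ∧ DifferentiableOn ℂ e.symm e.target

/-- Oda's Schwarzian derivative `S^k_{ij} f` at `z`. The partial derivatives `∂z_k/∂f_l` are the
entries of the inverse Jacobian matrix, and `∂_j log J_f` is `(∂_j J_f) / J_f`, independently of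
the branch of the logarithm. -/
def schwarzian {n : ℕ} (f : Cn n → Cn n) (k i j : Fin n) (z : Cn n) : ℂ :=
  (∑ l, pderiv i (pderiv j (fun w => f w l)) z * (jacMatrix f z)⁻¹ k l)
    - 1 / ((n : ℂ) + 1) *
      ((if k = i then pderiv j (jac f) z / jac f z else 0)
        + (if k = j then pderiv i (jac f) z / jac f z else 0))

/-- The Schwarzian derivative operator: the `k`-th entry of `S_f(z)(v)` is `vᵗ S^k_f(z) v`. -/
def schwarzianOp {n : ℕ} (f : Cn n → Cn n) (z v : Cn n) : Cn n :=
  WithLp.toLp 2 (fun k => ∑ i, ∑ j, v i * schwarzian f k i j z * v j)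

/-- The Bergman norm of a tangent vector `v` at a point `z` of the polydisk. -/
def bergmanNorm {n : ℕ} (z v : Cn n) : ℝ :=
  Real.sqrt (2 * ∑ i, ‖v i‖ ^ 2 / (1 - ‖z i‖ ^ 2) ^ 2)

/-- The norm `‖S_f‖`, the supremum over all points `z` of the polydisk and all Bergman unit
vectors `v` at `z` of the Bergman norm of `S_f(z)(v)`, as an extended nonnegative real. -/
def schwarzianNorm {n : ℕ} (f : Cn n → Cn n) : ℝ≥0∞ :=
  ⨆ z ∈ polydisk n, ⨆ v ∈ {v : Cn n | bergmanNorm z v = 1},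
    ENNReal.ofReal (bergmanNorm z (schwarzianOp f z v))

/-- The family `F_α`. Only the values of `f` on the polydisk matter. -/
def family (n : ℕ) (α : ℝ) : Set (Cn n → Cn n) :=
  {f | LocallyBiholomorphicOn f (polydisk n) ∧ f 0 = 0 ∧
    fderiv ℂ f 0 = ContinuousLinearMap.id ℂ (Cn n) ∧
    schwarzianNorm f ≤ ENNReal.ofReal α}

/-- The order `λ_α` of `F_α`, the supremum of the Euclidean norms `|∇J_f(0)|`, as an extended
nonnegative real. -/
def order (n : ℕ) (α : ℝ) : ℝ≥0∞ :=
  ⨆ f ∈ family n α, ENNReal.ofReal ‖grad (jac f) 0‖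

/-- The denominator `1 + a_1 w_1 + ⋯ + a_n w_n`. -/
def mobiusDenom {n : ℕ} (a w : Cn n) : ℂ := 1 + ∑ i, a i * w i

/-- The Möbius map `T_a(w) = w / (1 + a_1 w_1 + ⋯ + a_n w_n)`; it is only meant for those `w`
at which the denominator does not vanish. -/
def mobius {n : ℕ} (a w : Cn n) : Cn n := (mobiusDenom a w)⁻¹ • w

/-- The family `F_α^0` of all `g = T_a ∘ f` with `f` in `F_α` and `a` such that `∇J_g(0) = 0`
(`g(0) = 0` and `Dg(0) = I` hold for every `a`). Such a `g` is a partial map: its domain is the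
set of all points of the polydisk at which the denominator of `T_a ∘ f` does not vanish. -/
def normalizedFamily (n : ℕ) (α : ℝ) : Set (Cn n →. Cn n) :=
  {g | ∃ f ∈ family n α, ∃ a : Cn n,
    grad (jac (fun z => mobius a (f z))) 0 = 0 ∧
    g = PFun.res (fun z => mobius a (f z)) {z | z ∈ polydisk n ∧ mobiusDenom a (f z) ≠ 0}}

end

end PolydiskSchwarzian

namespace PolydiskSchwarzian

open Metric MeasureTheory Set Filter Topology
open scoped Matrix

/-! ### Holomorphic functions of several variables -/

section Holomorphic

variable {n : ℕ} {U : Set (Cn n)}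

/-! Write `p = d log J_f / (n+1)` and `u = J_f^{-1/(n+1)}`. The constants and the components of `f`
solve `∂_i∂_j φ = ∑ Γ^k_{ij} ∂_k φ`, where `Γ` is the flat connection with trace-free part
`S^k_{ij}` and trace part `p`. Passing to `uφ` removes `p`: `∂_i∂_j(uφ) = ∑ S^k_{ij} ∂_k(uφ) +
S^0_{ij} uφ`. Flatness of `Γ`, contracted once, expresses `(n-1) S^0` through `S` and its first
derivatives (`contracted_flatness`, `potential_eq`). Hence for `n ≥ 2` the bound on `‖S_f‖`, with
Cauchy's estimate, bounds every coefficient near the origin by a constant depending on `n` and `α`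
only (`norm_schwarzian_le`, `norm_potential_le`), although `p` itself is not yet controlled.

By Gronwall on rays, `uφ` and its gradient stay close to their values at `0`
(`exists_approx_initial_values`). Take `a = ∇J_f(0)/(n+1)`, which is exactly the choice normalizing
`g = T_a ∘ f` (`grad_jac_mobius`). The initial value and gradient are then `1, 0` for `u(1 + a·f)`
and `0, e_l` for `u f_l`. The factor `u` cancels in `g_l = u f_l / (u(1 + a·f))`, so `Dg` is close
to `I` on a ball of uniform radius, and `g` covers a ball of uniform radius `s_0`
(`exists_covering_radius`).

The rest is geometry of `T_a`. Its image omits the hyperplane `a·y = 1`, at distance `1/|a|` from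
`0`, so `|a| ≤ 1/s_0`; this is the bound on the order. On `|y| < s_0/2` it follows that `|1 + a·y| >
1/2`, so `T_a(y)` lies in the ball covered by `g`, and `y` in the image of `f`. -/

theorem hasDerivAt_line (z v : Cn n) (t : ℂ) : HasDerivAt (fun s : ℂ => z + s • v) v t := by
  simpa using ((hasDerivAt_id t).smul_const v).const_add z

theorem hasDerivAt_comp_line {h : Cn n → ℂ} {h' : Cn n →L[ℂ] ℂ} {z v : Cn n} {t : ℂ}
    (hh : HasFDerivAt h h' (z + t • v)) : HasDerivAt (fun s : ℂ => h (z + s • v)) (h' v) t :=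
  hh.comp_hasDerivAt t (hasDerivAt_line z v t)

/-- A directional derivative of a holomorphic function of several variables is holomorphic. -/
theorem differentiableOn_fderiv_apply (hU : IsOpen U) {h : Cn n → ℂ}
    (hh : DifferentiableOn ℂ h U) (e : Cn n) (he : ‖e‖ = 1) :
    DifferentiableOn ℂ (fun z => fderiv ℂ h z e) U := by
  intro z₀ hz₀
  apply DifferentiableAt.differentiableWithinAt
  have hd : ∀ z ∈ U, DifferentiableAt ℂ h z := fun z hz => hh.differentiableAt (hU.mem_nhds hz)
  -- Local boundedness of `h` bounds `fderiv ℂ h` by the Schwarz lemma. The radius is `3 * R`: one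
  -- `R` for the base point, one for the circle of integration, one for the ball used to estimate
  -- the derivative.
  have hnear : U ∩ {z | dist (h z) (h z₀) < 1} ∈ 𝓝 z₀ :=
    inter_mem (hU.mem_nhds hz₀)
      ((hd z₀ hz₀).continuousAt.eventually (ball_mem_nhds (h z₀) one_pos))
  obtain ⟨R', hR', hball⟩ := Metric.mem_nhds_iff.1 hnear
  obtain ⟨R, rfl⟩ : ∃ R, R' = 3 * R := ⟨R' / 3, by ring⟩
  have hR : 0 < R := by linarith
  have hcm : ∀ θ, ‖circleMap 0 R θ‖ = R := fun θ => by simp [abs_of_pos hR]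
  have hmem : ∀ z ∈ ball z₀ R, ∀ ζ : ℂ, ‖ζ‖ ≤ R → z + ζ • e ∈ ball z₀ (2 * R) := by
    intro z hz ζ hζ
    rw [mem_ball, dist_eq_norm] at hz ⊢
    calc ‖z + ζ • e - z₀‖ = ‖(z - z₀) + ζ • e‖ := by congr 1; abel
      _ ≤ ‖z - z₀‖ + ‖ζ • e‖ := norm_add_le _ _
      _ < 2 * R := by rw [norm_smul, he]; linarith
  have hsub : ball z₀ (2 * R) ⊆ U := fun z hz =>
    (hball (ball_subset_ball (by linarith) hz)).1
  have hbound : ∀ z ∈ ball z₀ (2 * R), ‖fderiv ℂ h z‖ ≤ 2 / R := by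
    intro z hz
    have hsub3 : ball z R ⊆ ball z₀ (3 * R) :=
      ball_subset_ball' (by rw [mem_ball] at hz; linarith)
    apply Complex.norm_fderiv_le_div_of_mapsTo_ball _ _ hR
    · exact fun w hw => (hd w (hball (hsub3 hw)).1).differentiableWithinAt
    · intro w hw
      have h1 := (hball (hsub3 hw)).2
      have h2 := (hball (ball_subset_ball (by linarith) hz)).2
      simp only [mem_ofPred_eq] at h1 h2
      rw [mem_closedBall]
      linarith [dist_triangle_right (h w) (h z) (h z₀)]
  -- The kernel `dζ / ζ²` of Cauchy's formula for the derivative at the centre. The formula on the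
  -- lines `z + ζ e` turns the directional derivative into an integral of `h`, which can be
  -- differentiated in `z` under the integral sign.
  set k : ℝ → ℂ := fun θ => deriv (circleMap 0 R) θ * (1 / circleMap 0 R θ ^ 2) with hk
  have hkn : ∀ θ, ‖k θ‖ = 1 / R := by
    intro θ
    simp only [hk, deriv_circleMap, norm_mul, norm_div, norm_pow, hcm, Complex.norm_I, norm_one]
    field_simp
  have hkc : Continuous k := by
    have h0 : ∀ θ, circleMap 0 R θ ^ 2 ≠ 0 := fun θ => by
      rw [← norm_ne_zero_iff, norm_pow, hcm]; positivity
    have hc : Continuous (circleMap 0 R) := continuous_circleMap 0 R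
    simp only [hk, deriv_circleMap]
    exact (hc.mul continuous_const).mul (continuous_const.div (hc.pow 2) h0)
  have hlc : ∀ z : Cn n, Continuous fun θ : ℝ => z + circleMap 0 R θ • e := fun z =>
    continuous_const.add ((continuous_circleMap 0 R).smul continuous_const)
  have hFc : ∀ z ∈ ball z₀ R, Continuous fun θ : ℝ => k θ * h (z + circleMap 0 R θ • e) := by
    intro z hz
    refine hkc.mul (continuous_iff_continuousAt.2 fun θ => ?_)
    exact ContinuousAt.comp (g := h)
      (hd _ (hsub (hmem z hz _ (hcm θ).le))).continuousAt (hlc z).continuousAt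
  have key := intervalIntegral.hasFDerivAt_integral_of_dominated_of_fderiv_le (𝕜 := ℂ)
    (μ := volume) (a := 0) (b := 2 * Real.pi) (x₀ := z₀) (s := ball z₀ R)
    (F := fun z θ => k θ * h (z + circleMap 0 R θ • e))
    (F' := fun z θ => k θ • fderiv ℂ h (z + circleMap 0 R θ • e))
    (bound := fun _ => 1 / R * (2 / R))
    (ball_mem_nhds _ hR)
    (by
      filter_upwards [ball_mem_nhds z₀ hR] with z hz
      exact (hFc z hz).aestronglyMeasurable)
    ((hFc z₀ (mem_ball_self hR)).intervalIntegrable _ _)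
    (by
      borelize (Cn n →L[ℂ] ℂ)
      apply Measurable.aestronglyMeasurable
      exact hkc.measurable.smul ((measurable_fderiv ℂ h).comp (hlc z₀).measurable))
    (by
      refine Eventually.of_forall fun θ _ z hz => ?_
      rw [norm_smul, hkn]
      exact mul_le_mul_of_nonneg_left (hbound _ (hmem z hz _ (hcm θ).le)) (by positivity))
    intervalIntegrable_const
    (by
      refine Eventually.of_forall fun θ _ z hz => ?_
      have h1 : HasFDerivAt (fun z : Cn n => h (z + circleMap 0 R θ • e))
          (fderiv ℂ h (z + circleMap 0 R θ • e)) z := by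
        have := (hd _ (hsub (hmem z hz _ (hcm θ).le))).hasFDerivAt.comp z
          ((hasFDerivAt_id z).add_const (circleMap 0 R θ • e))
        rwa [ContinuousLinearMap.comp_id] at this
      exact h1.const_mul (k θ))
  have hEq : ∀ᶠ z in 𝓝 z₀, fderiv ℂ h z e =
      (2 * Real.pi * Complex.I : ℂ)⁻¹ *
        ∫ θ in (0 : ℝ)..(2 * Real.pi), k θ * h (z + circleMap 0 R θ • e) := by
    filter_upwards [ball_mem_nhds z₀ hR] with z hz
    have hdl : ∀ ζ : ℂ, ‖ζ‖ ≤ R → HasDerivAt (fun s : ℂ => h (z + s • e))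
        (fderiv ℂ h (z + ζ • e) e) ζ := fun ζ hζ =>
      hasDerivAt_comp_line (hd _ (hsub (hmem z hz ζ hζ))).hasFDerivAt
    have hdc : DiffContOnCl ℂ (fun s : ℂ => h (z + s • e)) (ball 0 R) := by
      apply DifferentiableOn.diffContOnCl
      intro ζ hζ
      rw [closure_ball _ hR.ne', mem_closedBall_zero_iff] at hζ
      exact (hdl ζ hζ).differentiableAt.differentiableWithinAt
    have hcauchy := hdc.deriv_eq_smul_circleIntegral hR
    have h0 := (hdl 0 (by simpa using hR.le)).deriv
    rw [h0] at hcauchy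
    simp only [zero_smul, add_zero, sub_zero, smul_eq_mul] at hcauchy
    rw [eq_inv_mul_iff_mul_eq₀ (by simp [Real.pi_ne_zero]), ← hcauchy, circleIntegral]
    refine intervalIntegral.integral_congr fun θ _ => ?_
    simp only [hk, smul_eq_mul]
    ring
  exact (key.differentiableAt.const_mul _).congr_of_eventuallyEq hEq

theorem differentiableOn_pderiv (hU : IsOpen U) {h : Cn n → ℂ} (hh : DifferentiableOn ℂ h U)
    (i : Fin n) : DifferentiableOn ℂ (pderiv i h) U :=
  differentiableOn_fderiv_apply hU hh _ (by simp)

theorem fderiv_apply_eq_sum (h : Cn n → ℂ) (z v : Cn n) :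
    fderiv ℂ h z v = ∑ i, v i * pderiv i h z := by
  have hv : v = ∑ i, v i • EuclideanSpace.single i (1 : ℂ) := by
    ext k; simp [Finset.sum_apply, Pi.single_apply]
  conv_lhs => rw [hv]
  simp [pderiv]

theorem fderiv_eq_sum_pderiv (h : Cn n → ℂ) (z : Cn n) :
    fderiv ℂ h z = ∑ i, pderiv i h z • (EuclideanSpace.proj i : Cn n →L[ℂ] ℂ) := by
  ext v
  simp [fderiv_apply_eq_sum, mul_comm]

theorem pderiv_pderiv_comm (hU : IsOpen U) {h : Cn n → ℂ} (hh : DifferentiableOn ℂ h U)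
    (i j : Fin n) {z : Cn n} (hz : z ∈ U) :
    pderiv i (pderiv j h) z = pderiv j (pderiv i h) z := by
  have h1 : ∀ᶠ y in 𝓝 z, HasFDerivAt h (fderiv ℂ h y) y := by
    filter_upwards [hU.mem_nhds hz] with y hy
    exact (hh.differentiableAt (hU.mem_nhds hy)).hasFDerivAt
  have h2 : DifferentiableAt ℂ (fderiv ℂ h) z := by
    have h3 : fderiv ℂ h = fun y => ∑ i, pderiv i h y •
        (EuclideanSpace.proj i : Cn n →L[ℂ] ℂ) := funext fun y =>
      fderiv_eq_sum_pderiv h y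
    rw [h3]
    refine DifferentiableAt.fun_sum fun i _ => ?_
    exact ((differentiableOn_pderiv hU hh i).differentiableAt (hU.mem_nhds hz)).smul_const _
  have h4 : ∀ v w : Cn n, fderiv ℂ (fun y => fderiv ℂ h y w) z v =
      fderiv ℂ (fderiv ℂ h) z v w := fun v w => by
    rw [fderiv_clm_apply h2 (differentiableAt_const w)]
    simp
  have h5 := second_derivative_symmetric_of_eventually h1 h2.hasFDerivAt
  change fderiv ℂ (fun y => fderiv ℂ h y _) z _ = fderiv ℂ (fun y => fderiv ℂ h y _) z _
  rw [h4, h4, h5]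

theorem pderiv_congr (hU : IsOpen U) {g h : Cn n → ℂ} (hgh : EqOn g h U) (i : Fin n) {z : Cn n}
    (hz : z ∈ U) : pderiv i g z = pderiv i h z := by
  have : g =ᶠ[𝓝 z] h := by filter_upwards [hU.mem_nhds hz] with y hy using hgh hy
  rw [pderiv, pderiv, this.fderiv_eq]

theorem pderiv_mul {g h : Cn n → ℂ} {z : Cn n} (hg : DifferentiableAt ℂ g z)
    (hh : DifferentiableAt ℂ h z) (i : Fin n) :
    pderiv i (fun y => g y * h y) z = pderiv i g z * h z + g z * pderiv i h z := by
  rw [pderiv, fderiv_fun_mul hg hh]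
  simp [pderiv]; ring

theorem pderiv_add {g h : Cn n → ℂ} {z : Cn n} (hg : DifferentiableAt ℂ g z)
    (hh : DifferentiableAt ℂ h z) (i : Fin n) :
    pderiv i (fun y => g y + h y) z = pderiv i g z + pderiv i h z := by
  rw [pderiv, fderiv_fun_add hg hh]; rfl

theorem pderiv_sub {g h : Cn n → ℂ} {z : Cn n} (hg : DifferentiableAt ℂ g z)
    (hh : DifferentiableAt ℂ h z) (i : Fin n) :
    pderiv i (fun y => g y - h y) z = pderiv i g z - pderiv i h z := by
  rw [pderiv, fderiv_fun_sub hg hh]; rfl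

theorem pderiv_const_mul {g : Cn n → ℂ} {z : Cn n} (c : ℂ) (hg : DifferentiableAt ℂ g z)
    (i : Fin n) : pderiv i (fun y => c * g y) z = c * pderiv i g z := by
  rw [pderiv, fderiv_const_mul hg]; rfl

theorem pderiv_sum {ι : Type*} {s : Finset ι} {g : ι → Cn n → ℂ} {z : Cn n}
    (hg : ∀ l ∈ s, DifferentiableAt ℂ (g l) z) (i : Fin n) :
    pderiv i (fun y => ∑ l ∈ s, g l y) z = ∑ l ∈ s, pderiv i (g l) z := by
  rw [pderiv, fderiv_fun_sum hg]
  simp [pderiv]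

theorem differentiableAt_div {g h : Cn n → ℂ} {z : Cn n} (hg : DifferentiableAt ℂ g z)
    (hh : DifferentiableAt ℂ h z) (hz : h z ≠ 0) : DifferentiableAt ℂ (fun y => g y / h y) z := by
  simp only [div_eq_mul_inv]
  exact hg.mul (hh.inv hz)

theorem pderiv_div {g h : Cn n → ℂ} {z : Cn n} (hg : DifferentiableAt ℂ g z)
    (hh : DifferentiableAt ℂ h z) (hz : h z ≠ 0) (i : Fin n) :
    pderiv i (fun y => g y / h y) z = (pderiv i g z * h z - g z * pderiv i h z) / h z ^ 2 := by
  have h1 : HasDerivAt (fun s : ℂ => g (z + s • EuclideanSpace.single i (1 : ℂ))) (pderiv i g z) 0 :=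
    hasDerivAt_comp_line (by simpa using hg.hasFDerivAt)
  have h2 : HasDerivAt (fun s : ℂ => h (z + s • EuclideanSpace.single i (1 : ℂ))) (pderiv i h z) 0 :=
    hasDerivAt_comp_line (by simpa using hh.hasFDerivAt)
  have h3 : HasDerivAt (fun s : ℂ => (fun y => g y / h y) (z + s • EuclideanSpace.single i (1 : ℂ)))
      (pderiv i (fun y => g y / h y) z) 0 :=
    hasDerivAt_comp_line (h := fun y => g y / h y)
      (by simpa using (differentiableAt_div hg hh hz).hasFDerivAt)
  have h4 := h1.fun_div h2 (by simpa using hz)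
  simpa using h3.unique h4

/-- Cauchy's estimate for a partial derivative. -/
theorem norm_pderiv_le (hU : IsOpen U) {h : Cn n → ℂ} (hh : DifferentiableOn ℂ h U) {i : Fin n}
    {z : Cn n} {r C : ℝ} (hr : 0 < r)
    (hz : ∀ s : ℂ, ‖s‖ ≤ r → z + s • EuclideanSpace.single i (1 : ℂ) ∈ U)
    (hC : ∀ s : ℂ, ‖s‖ = r → ‖h (z + s • EuclideanSpace.single i (1 : ℂ))‖ ≤ C) :
    ‖pderiv i h z‖ ≤ C / r := by
  have hdl : ∀ ζ : ℂ, ‖ζ‖ ≤ r → HasDerivAt (fun s : ℂ => h (z + s • EuclideanSpace.single i (1 : ℂ)))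
      (fderiv ℂ h (z + ζ • EuclideanSpace.single i (1 : ℂ)) (EuclideanSpace.single i (1 : ℂ))) ζ :=
    fun ζ hζ => hasDerivAt_comp_line
      (hh.differentiableAt (hU.mem_nhds (hz ζ hζ))).hasFDerivAt
  have hdc : DiffContOnCl ℂ (fun s : ℂ => h (z + s • EuclideanSpace.single i (1 : ℂ))) (ball 0 r) := by
    apply DifferentiableOn.diffContOnCl
    intro ζ hζ
    rw [closure_ball _ hr.ne', mem_closedBall_zero_iff] at hζ
    exact (hdl ζ hζ).differentiableAt.differentiableWithinAt
  have h1 := Complex.norm_deriv_le_of_forall_mem_sphere_norm_le hr hdc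
    (fun s hs => hC s (by simpa using hs))
  rw [(hdl 0 (by simpa using hr.le)).deriv] at h1
  simpa [pderiv] using h1

end Holomorphic

/-! ### The flat connection of a locally biholomorphic mapping -/

section Connection

variable {n : ℕ} {U : Set (Cn n)} {f : Cn n → Cn n}

theorem differentiableAt_det {A : Cn n → Matrix (Fin n) (Fin n) ℂ} {z : Cn n}
    (hA : ∀ l m, DifferentiableAt ℂ (fun y => A y l m) z) :
    DifferentiableAt ℂ (fun y => (A y).det) z := by
  simp only [Matrix.det_apply]
  refine DifferentiableAt.fun_sum fun σ _ => ?_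
  exact (HasFDerivAt.finsetProd fun m _ =>
    (hA (σ m) m).hasFDerivAt).differentiableAt.const_smul _

/-- The derivative of a determinant, column by column. -/
theorem pderiv_det {A : Cn n → Matrix (Fin n) (Fin n) ℂ} {z : Cn n}
    (hA : ∀ l m, DifferentiableAt ℂ (fun y => A y l m) z) (i : Fin n) :
    pderiv i (fun y => (A y).det) z =
      ∑ m, ((A z).updateCol m fun l => pderiv i (fun y => A y l m) z).det := by
  have h1 : ∀ σ : Equiv.Perm (Fin n), HasFDerivAt (fun y => ∏ m, A y (σ m) m)
      (∑ m, (∏ j ∈ Finset.univ.erase m, A z (σ j) j) • fderiv ℂ (fun y => A y (σ m) m) z) z :=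
    fun σ => HasFDerivAt.finsetProd fun m _ => (hA (σ m) m).hasFDerivAt
  have h2 : HasFDerivAt (fun y => (A y).det)
      (∑ σ : Equiv.Perm (Fin n), Equiv.Perm.sign σ •
        ∑ m, (∏ j ∈ Finset.univ.erase m, A z (σ j) j) • fderiv ℂ (fun y => A y (σ m) m) z) z := by
    simp only [Matrix.det_apply]
    exact HasFDerivAt.fun_sum fun σ _ => (h1 σ).const_smul _
  rw [pderiv, h2.fderiv]
  simp only [Matrix.det_apply, sum_apply, smul_apply, Finset.smul_sum]
  rw [Finset.sum_comm]
  refine Finset.sum_congr rfl fun m _ => Finset.sum_congr rfl fun σ _ => ?_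
  rw [← Finset.mul_prod_erase Finset.univ _ (Finset.mem_univ m), Matrix.updateCol_self, mul_comm,
    smul_eq_mul, pderiv]
  congr 2
  refine Finset.prod_congr rfl fun j hj => ?_
  rw [Matrix.updateCol_ne (Finset.ne_of_mem_erase hj)]

noncomputable section

/-- The connection coefficients `Γ^k_{ij} = ∑ l, ∂_i ∂_j f_l · ∂z_k/∂f_l` of `f`. -/
def connection (f : Cn n → Cn n) (k i j : Fin n) (z : Cn n) : ℂ :=
  ∑ l, pderiv i (pderiv j (fun w => f w l)) z * (jacMatrix f z)⁻¹ k l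

/-- The normalized logarithmic derivative `∂_j log J_f / (n + 1)`. -/
def logJac (f : Cn n → Cn n) (j : Fin n) (z : Cn n) : ℂ :=
  1 / ((n : ℂ) + 1) * (pderiv j (jac f) z / jac f z)

end

/-- Splits the connection into its Schwarzian part and its trace part, the latter built from `d log
J_f / (n+1)`. -/
theorem schwarzian_eq (f : Cn n → Cn n) (k i j : Fin n) (z : Cn n) :
    schwarzian f k i j z = connection f k i j z -
      ((if k = i then logJac f j z else 0) + (if k = j then logJac f i z else 0)) := by
  simp only [schwarzian, connection, logJac]
  split_ifs <;> ring

/-- The second derivatives of the components of `f` in terms of the connection. -/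
theorem hessian_eq {z : Cn n} (hJ : jac f z ≠ 0) (l i j : Fin n) :
    pderiv i (pderiv j (fun w => f w l)) z =
      ∑ k, connection f k i j z * pderiv k (fun w => f w l) z := by
  have hM : (jacMatrix f z) * (jacMatrix f z)⁻¹ = 1 :=
    Matrix.mul_nonsing_inv _ (isUnit_iff_ne_zero.2 hJ)
  have h1 : ∀ m, ∑ k, (jacMatrix f z)⁻¹ k m * pderiv k (fun w => f w l) z =
      if l = m then 1 else 0 := fun m => by
    have := congrFun (congrFun hM l) m
    rw [Matrix.mul_apply, Matrix.one_apply] at this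
    rw [← this]
    exact Finset.sum_congr rfl fun k _ => mul_comm _ _
  simp only [connection, Finset.sum_mul]
  rw [Finset.sum_comm]
  simp only [mul_assoc, ← Finset.mul_sum, h1]
  simp

theorem differentiableOn_jac (hU : IsOpen U)
    (hf : ∀ l, DifferentiableOn ℂ (fun z => f z l) U) : DifferentiableOn ℂ (jac f) U :=
  fun _ hz => (differentiableAt_det fun l m =>
    (differentiableOn_pderiv hU (hf l) m).differentiableAt (hU.mem_nhds hz)).differentiableWithinAt

/-- Cramer's rule: each entry of the inverse is a quotient of determinants with holomorphic entries.
-/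
theorem differentiableOn_jacMatrix_inv (hU : IsOpen U)
    (hf : ∀ l, DifferentiableOn ℂ (fun z => f z l) U) (hJ : ∀ z ∈ U, jac f z ≠ 0) (k l : Fin n) :
    DifferentiableOn ℂ (fun z => (jacMatrix f z)⁻¹ k l) U := by
  intro z hz
  have h1 : (fun z => (jacMatrix f z)⁻¹ k l) =
      fun z => ((jacMatrix f z).updateRow l (Pi.single k 1)).det / jac f z := by
    ext z
    rw [Matrix.inv_def, Matrix.smul_apply, Matrix.adjugate_apply, Ring.inverse_eq_inv', smul_eq_mul,
      div_eq_inv_mul, jac]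
  rw [h1]
  refine (differentiableAt_div (differentiableAt_det fun a b => ?_)
    ((differentiableOn_jac hU hf).differentiableAt (hU.mem_nhds hz)) (hJ z hz)).differentiableWithinAt
  by_cases hal : a = l
  · simp [hal]
  · simp only [Matrix.updateRow_ne hal]
    exact (differentiableOn_pderiv hU (hf a) b).differentiableAt (hU.mem_nhds hz)

theorem differentiableOn_connection (hU : IsOpen U)
    (hf : ∀ l, DifferentiableOn ℂ (fun z => f z l) U) (hJ : ∀ z ∈ U, jac f z ≠ 0)
    (k i j : Fin n) : DifferentiableOn ℂ (connection f k i j) U :=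
  DifferentiableOn.fun_sum fun l _ =>
    (differentiableOn_pderiv hU (differentiableOn_pderiv hU (hf l) j) i).mul
      (differentiableOn_jacMatrix_inv hU hf hJ k l)

theorem differentiableOn_logJac (hU : IsOpen U)
    (hf : ∀ l, DifferentiableOn ℂ (fun z => f z l) U) (hJ : ∀ z ∈ U, jac f z ≠ 0)
    (j : Fin n) : DifferentiableOn ℂ (logJac f j) U := fun z hz =>
  ((differentiableAt_div
    ((differentiableOn_pderiv hU (differentiableOn_jac hU hf) j).differentiableAt (hU.mem_nhds hz))
    ((differentiableOn_jac hU hf).differentiableAt (hU.mem_nhds hz)) (hJ z hz)).const_mul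
      _).differentiableWithinAt

theorem differentiableOn_schwarzian (hU : IsOpen U)
    (hf : ∀ l, DifferentiableOn ℂ (fun z => f z l) U) (hJ : ∀ z ∈ U, jac f z ≠ 0)
    (k i j : Fin n) : DifferentiableOn ℂ (schwarzian f k i j) U := by
  rw [show schwarzian f k i j = _ from funext (schwarzian_eq f k i j)]
  refine (differentiableOn_connection hU hf hJ k i j).sub (DifferentiableOn.add ?_ ?_)
  · split_ifs
    exacts [differentiableOn_logJac hU hf hJ j, differentiableOn_const _]
  · split_ifs
    exacts [differentiableOn_logJac hU hf hJ i, differentiableOn_const _]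

theorem connection_symm (hU : IsOpen U) (hf : ∀ l, DifferentiableOn ℂ (fun z => f z l) U)
    (k i j : Fin n) {z : Cn n} (hz : z ∈ U) : connection f k i j z = connection f k j i z :=
  Finset.sum_congr rfl fun l _ => by rw [pderiv_pderiv_comm hU (hf l) i j hz]

theorem schwarzian_symm (hU : IsOpen U) (hf : ∀ l, DifferentiableOn ℂ (fun z => f z l) U)
    (k i j : Fin n) {z : Cn n} (hz : z ∈ U) : schwarzian f k i j z = schwarzian f k j i z := by
  rw [schwarzian_eq, schwarzian_eq, connection_symm hU hf k i j hz, add_comm]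

/-- Jacobi's formula: the trace of the connection is the logarithmic derivative of `J_f`. -/
theorem sum_connection (hU : IsOpen U) (hf : ∀ l, DifferentiableOn ℂ (fun z => f z l) U)
    (i : Fin n) {z : Cn n} (hz : z ∈ U) (hJ : jac f z ≠ 0) :
    ∑ k, connection f k i k z = ((n : ℂ) + 1) * logJac f i z := by
  have hn : (n : ℂ) + 1 ≠ 0 := Nat.cast_add_one_ne_zero n
  have h1 : pderiv i (jac f) z = (∑ k, connection f k i k z) * jac f z := by
    have h2 := pderiv_det (A := jacMatrix f) (z := z) (fun l m =>
      (differentiableOn_pderiv hU (hf l) m).differentiableAt (hU.mem_nhds hz)) i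
    change pderiv i (fun y => (jacMatrix f y).det) z = _
    rw [h2, Finset.sum_mul]
    refine Finset.sum_congr rfl fun m _ => ?_
    -- The differentiated column `m` is `∑ k, Γ^k_{im}` times column `k`; in the determinant only
    -- the term `k = m` survives.
    refine Eq.trans ?_ (Matrix.det_updateCol_sum (jacMatrix f z) m fun k => connection f k i m z)
    congr 2
    ext l
    exact hessian_eq hJ l i m
  rw [logJac, h1]
  field_simp

/-- The factor `1/(n+1)` is chosen for this: the subtracted delta terms have trace `(n+1) p_i`,
which by Jacobi's formula is the trace of the connection. -/
theorem schwarzian_trace (hU : IsOpen U) (hf : ∀ l, DifferentiableOn ℂ (fun z => f z l) U)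
    (i : Fin n) {z : Cn n} (hz : z ∈ U) (hJ : jac f z ≠ 0) :
    ∑ k, schwarzian f k i k z = 0 := by
  simp only [schwarzian_eq, Finset.sum_sub_distrib, Finset.sum_add_distrib,
    sum_connection hU hf i hz hJ]
  simp
  ring

/-- The form `∑ p_j dz_j` is closed, being locally the differential of `log J_f / (n+1)`. -/
theorem pderiv_logJac_symm (hU : IsOpen U) (hf : ∀ l, DifferentiableOn ℂ (fun z => f z l) U)
    (i j : Fin n) {z : Cn n} (hz : z ∈ U) (hJ : jac f z ≠ 0) :
    pderiv i (logJac f j) z = pderiv j (logJac f i) z := by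
  have hd := differentiableOn_jac hU hf
  have hd1 := hd.differentiableAt (hU.mem_nhds hz)
  have hd2 := fun m => (differentiableOn_pderiv hU hd m).differentiableAt (hU.mem_nhds hz)
  have h : ∀ a b : Fin n, pderiv a (logJac f b) z = 1 / ((n : ℂ) + 1) *
      ((pderiv a (pderiv b (jac f)) z * jac f z - pderiv b (jac f) z * pderiv a (jac f) z) /
        jac f z ^ 2) := fun a b => by
    rw [← pderiv_div (hd2 b) hd1 hJ a]
    exact pderiv_const_mul _ (differentiableAt_div (hd2 b) hd1 hJ) a
  rw [h, h, pderiv_pderiv_comm hU hd i j hz]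
  ring

/-- The curvature of the connection of `f` vanishes. -/
theorem connection_flat (hU : IsOpen U) (hf : ∀ l, DifferentiableOn ℂ (fun z => f z l) U)
    (hJ : ∀ z ∈ U, jac f z ≠ 0) (k i j m : Fin n) {z : Cn n} (hz : z ∈ U) :
    pderiv i (connection f k j m) z + ∑ r, connection f k i r z * connection f r j m z =
      pderiv j (connection f k i m) z + ∑ r, connection f k j r z * connection f r i m z := by
  have hnhds := hU.mem_nhds hz
  have hC := fun k i j => (differentiableOn_connection hU hf hJ k i j).differentiableAt hnhds
  have hP := fun k l => (differentiableOn_pderiv hU (hf l) k).differentiableAt hnhds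
  -- The coefficients of `∂_i∂_j∂_m f` in the frame `∂_k f`. Third derivatives commute and the frame
  -- is a basis since `J_f ≠ 0`, so `K` is symmetric in `i` and `j`.
  set K : Fin n → Fin n → Fin n → ℂ := fun i j k =>
    pderiv i (connection f k j m) z + ∑ r, connection f k i r z * connection f r j m z with hK
  have h1 : ∀ (i j l : Fin n), pderiv i (pderiv j (pderiv m fun w => f w l)) z =
      ∑ k, K i j k * pderiv k (fun w => f w l) z := by
    intro i j l
    have h2 : EqOn (pderiv j (pderiv m fun w => f w l))
        (fun y => ∑ k, connection f k j m y * pderiv k (fun w => f w l) y) U :=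
      fun y hy => hessian_eq (hJ y hy) l j m
    rw [pderiv_congr hU h2 i hz, pderiv_sum (fun k _ => (hC k j m).fun_mul (hP k l))]
    simp only [pderiv_mul (hC _ _ _) (hP _ _), hessian_eq (hJ z hz), hK, add_mul,
      Finset.sum_add_distrib, Finset.mul_sum, Finset.sum_mul]
    congr 1
    rw [Finset.sum_comm]
    refine Finset.sum_congr rfl fun r _ => Finset.sum_congr rfl fun s _ => ?_
    ring
  have h3 : jacMatrix f z *ᵥ (K i j) = jacMatrix f z *ᵥ (K j i) := by
    ext l
    simp only [Matrix.mulVec, dotProduct]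
    have h4 := pderiv_pderiv_comm hU (differentiableOn_pderiv hU (hf l) m) i j hz
    rw [h1, h1] at h4
    simp only [mul_comm (K _ _ _)] at h4
    exact h4
  exact congrFun (Matrix.mulVec_injective_of_isUnit
    ((Matrix.isUnit_iff_isUnit_det _).2 (isUnit_iff_ne_zero.2 (hJ z hz))) h3) k

end Connection

/-! ### The zeroth order coefficient of the linear system -/

section Potential

variable {n : ℕ} {U : Set (Cn n)} {f : Cn n → Cn n}

/-- The contraction of the curvature of a connection with trace-free part `S` and trace part `p`. -/
theorem contracted_flatness {S : Fin n → Fin n → Fin n → ℂ} {p : Fin n → ℂ}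
    {dS : Fin n → Fin n → Fin n → Fin n → ℂ} {dp : Fin n → Fin n → ℂ}
    {Γ : Fin n → Fin n → Fin n → ℂ} {dΓ : Fin n → Fin n → Fin n → Fin n → ℂ}
    (hΓ : ∀ k i j, Γ k i j = S k i j + ((if k = i then p j else 0) + (if k = j then p i else 0)))
    (hdΓ : ∀ a k i j, dΓ a k i j =
      dS a k i j + ((if k = i then dp a j else 0) + (if k = j then dp a i else 0)))
    (hsymm : ∀ k i j, S k i j = S k j i) (htr : ∀ i, ∑ k, S k i k = 0)
    (hdtr : ∀ a i, ∑ k, dS a k k i = 0) (hdp : ∀ i j, dp i j = dp j i)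
    (hflat : ∀ k i j m, dΓ i k j m + ∑ r, Γ k i r * Γ r j m =
      dΓ j k i m + ∑ r, Γ k j r * Γ r i m) (i j : Fin n) :
    ((n : ℂ) - 1) * (-dp i j + p i * p j + ∑ k, S k i j * p k) =
      ∑ k, ∑ r, S k i r * S r k j - ∑ k, dS k k i j := by
  -- Contract the upper index with the first derivative index. The coefficients of `-dp`, `p_i p_j`
  -- and `∑ S^k_{ij} p_k` become `(n+1) - 2`, `2(n+1) - (n+3)` and `(n+1) - 2`, all equal to `n -
  -- 1`, so the three terms assemble into the potential.
  have h := Finset.sum_congr rfl fun a (_ : a ∈ (Finset.univ : Finset (Fin n))) => hflat a a i j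
  have htr' : ∀ i, ∑ k, S k k i = 0 := fun i => by
    rw [← htr i]; exact Finset.sum_congr rfl fun k _ => hsymm k k i
  have e1 : ∑ a, dΓ a a i j = ∑ a, dS a a i j + 2 * dp i j := by
    simp only [hdΓ, Finset.sum_add_distrib, Finset.sum_ite_eq', Finset.mem_univ, if_true]
    rw [hdp j i]; ring
  have e2 : ∑ a, dΓ i a a j = ((n : ℂ) + 1) * dp i j := by
    simp only [hdΓ, Finset.sum_add_distrib, hdtr, Finset.sum_ite_eq', Finset.mem_univ, if_true]
    simp; ring
  have e3 : ∑ a, ∑ r, Γ a a r * Γ r i j =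
      ((n : ℂ) + 1) * (∑ k, S k i j * p k + 2 * (p i * p j)) := by
    rw [Finset.sum_comm]
    have : ∀ r, ∑ a, Γ a a r = ((n : ℂ) + 1) * p r := fun r => by
      simp only [hΓ, Finset.sum_add_distrib, htr', Finset.sum_ite_eq', Finset.mem_univ, if_true]
      simp; ring
    simp only [← Finset.sum_mul, this]
    simp only [hΓ, mul_assoc, ← Finset.mul_sum, mul_add, Finset.sum_add_distrib, mul_ite, mul_zero,
      Finset.sum_ite_eq', Finset.mem_univ, if_true]
    simp only [mul_comm (p _) (S _ _ _)]
    ring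
  have e4 : ∑ a, ∑ r, Γ a i r * Γ r a j =
      ∑ k, ∑ r, S k i r * S r k j + 2 * ∑ k, S k i j * p k + ((n : ℂ) + 3) * (p i * p j) := by
    simp only [hΓ, add_mul, mul_add, Finset.sum_add_distrib, mul_ite, ite_mul, mul_zero, zero_mul,
      Finset.sum_ite_eq, Finset.sum_ite_eq', Finset.mem_univ, if_true, ← Finset.sum_mul,
      Finset.sum_const, Finset.card_univ, Fintype.card_fin, nsmul_eq_mul, Finset.sum_ite_irrel,
      htr]
    simp only [mul_comm (p _) (S _ _ _)]
    have h0 : ∑ k, S k k j * p i = 0 := by rw [← Finset.sum_mul, htr', zero_mul]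
    linear_combination h0
  rw [Finset.sum_add_distrib, Finset.sum_add_distrib, e1, e2, e3, e4] at h
  linear_combination h

noncomputable section

/-- The coefficient `S^0_{ij}` of the linear system satisfied by `J_f^{-1/(n+1)}`. -/
def potential (f : Cn n → Cn n) (i j : Fin n) (z : Cn n) : ℂ :=
  -pderiv i (logJac f j) z + logJac f i z * logJac f j z +
    ∑ k, schwarzian f k i j z * logJac f k z

end

theorem connection_eq (f : Cn n → Cn n) (k i j : Fin n) (z : Cn n) :
    connection f k i j z = schwarzian f k i j z +
      ((if k = i then logJac f j z else 0) + (if k = j then logJac f i z else 0)) := by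
  rw [schwarzian_eq]; ring

/-- In dimension `n ≥ 2` the potential is determined by the Schwarzian derivative. -/
theorem potential_eq (hU : IsOpen U) (hf : ∀ l, DifferentiableOn ℂ (fun z => f z l) U)
    (hJ : ∀ z ∈ U, jac f z ≠ 0) (i j : Fin n) {z : Cn n} (hz : z ∈ U) :
    ((n : ℂ) - 1) * potential f i j z =
      ∑ k, ∑ r, schwarzian f k i r z * schwarzian f r k j z -
        ∑ k, pderiv k (schwarzian f k i j) z := by
  have hnhds := hU.mem_nhds hz
  have hS := fun k i j => (differentiableOn_schwarzian hU hf hJ k i j).differentiableAt hnhds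
  have hL := fun j => (differentiableOn_logJac hU hf hJ j).differentiableAt hnhds
  refine contracted_flatness (S := fun k i j => schwarzian f k i j z) (p := fun j => logJac f j z)
    (dS := fun a k i j => pderiv a (schwarzian f k i j) z)
    (dp := fun a j => pderiv a (logJac f j) z)
    (Γ := fun k i j => connection f k i j z) (dΓ := fun a k i j => pderiv a (connection f k i j) z)
    (fun k i j => connection_eq f k i j z) (fun a k i j => ?_)
    (fun k i j => schwarzian_symm hU hf k i j hz)
    (fun i => schwarzian_trace hU hf i hz (hJ z hz)) (fun a i => ?_)
    (fun i j => pderiv_logJac_symm hU hf i j hz (hJ z hz))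
    (fun k i j m => connection_flat hU hf hJ k i j m hz) i j
  · have hite : ∀ (c : Prop) [Decidable c] (l : Fin n),
        DifferentiableAt ℂ (fun y => if c then logJac f l y else 0) z ∧
          pderiv a (fun y => if c then logJac f l y else 0) z =
            if c then pderiv a (logJac f l) z else 0 := fun c _ l => by
      by_cases hc : c
      · simp only [hc, if_true]; exact ⟨hL l, trivial⟩
      · simp [hc, pderiv]
    rw [show connection f k i j = _ from funext (connection_eq f k i j),
      pderiv_add (hS k i j) ((hite _ _).1.fun_add (hite _ _).1),
      pderiv_add (hite _ _).1 (hite _ _).1, (hite _ _).2, (hite _ _).2]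
  · have h0 : EqOn (fun y => ∑ k, schwarzian f k k i y) (fun _ => 0) U := fun y hy => by
      change ∑ k, schwarzian f k k i y = 0
      rw [← schwarzian_trace hU hf i hy (hJ y hy)]
      exact Finset.sum_congr rfl fun k _ => schwarzian_symm hU hf k k i hy
    rw [← pderiv_sum fun k _ => hS k k i, pderiv_congr hU h0 a hz]
    simp [pderiv]

end Potential

/-! ### Bounds for the coefficients of the linear system -/

section Bounds

variable {n : ℕ} {f : Cn n → Cn n}

theorem isOpen_polydisk (n : ℕ) : IsOpen (polydisk n) := by
  simp only [polydisk, ofPred_forall]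
  exact isOpen_iInter_of_finite fun i =>
    isOpen_lt ((EuclideanSpace.proj (𝕜 := ℂ) i).continuous.norm) continuous_const

theorem bergmanNorm_nonneg (z v : Cn n) : 0 ≤ bergmanNorm z v := Real.sqrt_nonneg _

theorem bergmanNorm_smul (z v : Cn n) (c : ℂ) : bergmanNorm z (c • v) = ‖c‖ * bergmanNorm z v := by
  rw [bergmanNorm, bergmanNorm]
  rw [← Real.sqrt_sq (norm_nonneg c), ← Real.sqrt_mul (sq_nonneg _)]
  congr 1
  simp only [PiLp.smul_apply, smul_eq_mul, norm_mul, mul_pow, mul_div_assoc, ← Finset.mul_sum]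
  ring

theorem schwarzianOp_smul (f : Cn n → Cn n) (z v : Cn n) (c : ℂ) :
    schwarzianOp f z (c • v) = c ^ 2 • schwarzianOp f z v := by
  ext k
  simp only [schwarzianOp, PiLp.smul_apply, smul_eq_mul, Finset.mul_sum]
  exact Finset.sum_congr rfl fun i _ => Finset.sum_congr rfl fun j _ => by ring

theorem sq_sub_pos {x : ℝ} (h0 : 0 ≤ x) (h : x < 1) : 0 < (1 - x ^ 2) ^ 2 := by
  have : x ^ 2 < 1 := by nlinarith
  exact pow_pos (by linarith) 2

theorem norm_le_bergmanNorm {z : Cn n} (hz : z ∈ polydisk n) (w : Cn n) (k : Fin n) :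
    ‖w k‖ ≤ bergmanNorm z w := by
  refine Real.le_sqrt_of_sq_le ?_
  have h1 : ‖w k‖ ^ 2 ≤ ‖w k‖ ^ 2 / (1 - ‖z k‖ ^ 2) ^ 2 := by
    rw [le_div_iff₀ (sq_sub_pos (norm_nonneg _) (hz k))]
    have h2 : (1 - ‖z k‖ ^ 2) ^ 2 ≤ 1 := by
      have := hz k
      have h3 : ‖z k‖ ^ 2 < 1 := by nlinarith [norm_nonneg (z k)]
      exact pow_le_one₀ (by linarith) (by linarith [sq_nonneg ‖z k‖])
    exact mul_le_of_le_one_right (sq_nonneg _) h2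
  have h2 : ‖w k‖ ^ 2 / (1 - ‖z k‖ ^ 2) ^ 2 ≤ ∑ i, ‖w i‖ ^ 2 / (1 - ‖z i‖ ^ 2) ^ 2 :=
    Finset.single_le_sum (f := fun i => ‖w i‖ ^ 2 / (1 - ‖z i‖ ^ 2) ^ 2)
      (fun i _ => by positivity) (Finset.mem_univ k)
  have h3 : 0 ≤ ‖w k‖ ^ 2 / (1 - ‖z k‖ ^ 2) ^ 2 := by positivity
  linarith

/-- For `|z_i| ≤ 1/2` the weight `2/(1-|z_i|²)²` is at most `32/9 < 4`. -/
theorem bergmanNorm_sq_le {z : Cn n} (hz : ∀ i, ‖z i‖ ≤ 1 / 2) (v : Cn n) :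
    bergmanNorm z v ^ 2 ≤ 4 * ∑ i, ‖v i‖ ^ 2 := by
  rw [bergmanNorm, Real.sq_sqrt (by positivity),
    show (4 : ℝ) * ∑ i, ‖v i‖ ^ 2 = 2 * ∑ i, 2 * ‖v i‖ ^ 2 by rw [← Finset.mul_sum]; ring]
  gcongr with i _
  have h1 : ‖z i‖ ^ 2 ≤ 1 / 4 := by nlinarith [norm_nonneg (z i), hz i]
  rw [div_le_iff₀ (sq_sub_pos (norm_nonneg _) ((hz i).trans_lt (by norm_num)))]
  nlinarith [mul_nonneg (sq_nonneg ‖v i‖) (sub_nonneg.2 h1), sq_nonneg ‖v i‖, sq_nonneg ‖z i‖,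
    mul_nonneg (sq_nonneg ‖v i‖) (sq_nonneg ‖z i‖), mul_nonneg (mul_nonneg (sq_nonneg ‖v i‖) (sq_nonneg ‖z i‖)) (sq_nonneg ‖z i‖)]

/-- The operator is homogeneous of degree two in `v`, so the bound on unit vectors extends to all
vectors by scaling. -/
theorem bergmanNorm_schwarzianOp_le {α : ℝ} (hα : 0 ≤ α)
    (hS : schwarzianNorm f ≤ ENNReal.ofReal α) {z : Cn n} (hz : z ∈ polydisk n) (v : Cn n) :
    bergmanNorm z (schwarzianOp f z v) ≤ α * bergmanNorm z v ^ 2 := by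
  rcases (bergmanNorm_nonneg z v).eq_or_lt with hb | hb
  · have hv : v = 0 := by
      ext k
      have := norm_le_bergmanNorm hz v k
      rw [← hb] at this
      simpa using this
    have h0 : schwarzianOp f z v = 0 := by
      have := schwarzianOp_smul f z v 0
      simpa [hv] using this
    have h1 := bergmanNorm_smul z (0 : Cn n) 0
    rw [h0, ← hb]
    simp only [smul_zero, norm_zero, zero_mul] at h1
    simp [h1]
  · set b := bergmanNorm z v
    have hbC : ‖((b : ℂ))⁻¹‖ = b⁻¹ := by simp [abs_of_pos hb]
    have h1 : bergmanNorm z ((b : ℂ)⁻¹ • v) = 1 := by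
      rw [bergmanNorm_smul, hbC, inv_mul_cancel₀ hb.ne']
    have h2 : ENNReal.ofReal (bergmanNorm z (schwarzianOp f z ((b : ℂ)⁻¹ • v))) ≤
        ENNReal.ofReal α :=
      le_trans (le_trans (le_iSup₂ (f := fun (v : Cn n) (_ : v ∈ {v : Cn n | bergmanNorm z v = 1}) =>
        ENNReal.ofReal (bergmanNorm z (schwarzianOp f z v))) ((b : ℂ)⁻¹ • v) h1)
        (le_iSup₂ (f := fun (z : Cn n) (_ : z ∈ polydisk n) =>
          ⨆ v ∈ {v : Cn n | bergmanNorm z v = 1},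
            ENNReal.ofReal (bergmanNorm z (schwarzianOp f z v))) z hz)) hS
    rw [ENNReal.ofReal_le_ofReal_iff hα, schwarzianOp_smul, bergmanNorm_smul, norm_pow, hbC] at h2
    rw [inv_pow, inv_mul_le_iff₀ (by positivity)] at h2
    linarith

/-- Polarization of a bound for a quadratic form. -/
theorem norm_polarization_le {B : Fin n → Fin n → ℂ} (hB : ∀ i j, B i j = B j i) {C : ℝ}
    (h : ∀ v : Cn n, ‖∑ i, ∑ j, v i * B i j * v j‖ ≤ C * ∑ i, ‖v i‖ ^ 2) (i j : Fin n) :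
    ‖B i j‖ ≤ 3 * C := by
  set Q : Cn n → ℂ := fun v => ∑ i, ∑ j, v i * B i j * v j with hQ
  set e : Fin n → Cn n := fun i => EuclideanSpace.single i (1 : ℂ) with he
  have hei : ∀ i j, (e i) j = if j = i then 1 else 0 := fun i j => by
    simp [he]
  have h1 : ∀ i, Q (e i) = B i i := fun i => by
    simp [hQ, hei]
  have h2 : Q (e i + e j) = Q (e i) + Q (e j) + 2 * B i j := by
    have : Q (e i + e j) = Q (e i) + Q (e j) + B i j + B j i := by
      rw [h1, h1]
      simp only [hQ, PiLp.add_apply, hei]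
      simp only [add_mul, mul_add, Finset.sum_add_distrib, ite_mul, mul_ite, one_mul, mul_one,
        zero_mul, mul_zero, Finset.sum_ite_eq', Finset.mem_univ, if_true]
      ring
    rw [this, hB j i]; ring
  have h3 : ∀ i, ‖Q (e i)‖ ≤ C := fun i => by
    refine (h (e i)).trans_eq ?_
    have : ∀ j, ‖(e i) j‖ ^ 2 = if j = i then 1 else 0 := fun j => by
      rw [hei]; split_ifs <;> simp
    simp [this]
  have hC : 0 ≤ C := (norm_nonneg _).trans (h3 i)
  -- The squared norm of `e_i + e_j` is `2` for `i ≠ j` and `4` for `i = j`; the bound `4` serves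
  -- both cases, and polarization gives `(4 + 1 + 1)/2 = 3`.
  have h4 : ‖Q (e i + e j)‖ ≤ 4 * C := by
    refine (h _).trans ?_
    have : ∀ l, ‖(e i + e j) l‖ ^ 2 ≤ (if l = i then 2 else 0) + (if l = j then 2 else 0) :=
      fun l => by
        rw [PiLp.add_apply, hei, hei]
        split_ifs <;> norm_num
    have := Finset.sum_le_sum fun l (_ : l ∈ Finset.univ) => this l
    simp only [Finset.sum_add_distrib, Finset.sum_ite_eq', Finset.mem_univ, if_true] at this
    nlinarith
  have h5 : 2 * B i j = Q (e i + e j) - Q (e i) - Q (e j) := by rw [h2]; ring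
  have h6 : ‖2 * B i j‖ ≤ 4 * C + C + C := by
    rw [h5]
    exact (norm_sub_le _ _).trans (add_le_add ((norm_sub_le _ _).trans (add_le_add h4 (h3 i))) (h3 j))
  rw [norm_mul, Complex.norm_ofNat] at h6
  linarith

/-- The constant is `4` from comparing the Bergman and Euclidean norms, times `3` from polarization.
-/
theorem norm_schwarzian_le {α : ℝ} (hα : 0 ≤ α)
    (hf : ∀ l, DifferentiableOn ℂ (fun z => f z l) (polydisk n))
    (hS : schwarzianNorm f ≤ ENNReal.ofReal α) {z : Cn n} (hz : ∀ i, ‖z i‖ ≤ 1 / 2)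
    (k i j : Fin n) : ‖schwarzian f k i j z‖ ≤ 12 * α := by
  have hzU : z ∈ polydisk n := fun i => (hz i).trans_lt (by norm_num)
  have h := norm_polarization_le (B := fun i j => schwarzian f k i j z) (C := 4 * α)
    (fun i j => schwarzian_symm (isOpen_polydisk n) hf k i j hzU) (fun v => by
      calc ‖∑ i, ∑ j, v i * schwarzian f k i j z * v j‖ = ‖schwarzianOp f z v k‖ := rfl
        _ ≤ α * bergmanNorm z v ^ 2 := (norm_le_bergmanNorm hzU _ k).trans
            (bergmanNorm_schwarzianOp_le hα hS hzU v)
        _ ≤ α * (4 * ∑ i, ‖v i‖ ^ 2) := by gcongr; exact bergmanNorm_sq_le hz v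
        _ = 4 * α * ∑ i, ‖v i‖ ^ 2 := by ring) i j
  linarith

/-- Cauchy's estimate on discs of radius `1/4`, which stay in the region `|z_i| ≤ 1/2` where the
coefficients are at most `12 * α`. -/
theorem norm_pderiv_schwarzian_le {α : ℝ} (hα : 0 ≤ α)
    (hf : ∀ l, DifferentiableOn ℂ (fun z => f z l) (polydisk n))
    (hJ : ∀ z ∈ polydisk n, jac f z ≠ 0)
    (hS : schwarzianNorm f ≤ ENNReal.ofReal α) {z : Cn n} (hz : ∀ i, ‖z i‖ ≤ 1 / 4)
    (a k i j : Fin n) : ‖pderiv a (schwarzian f k i j) z‖ ≤ 48 * α := by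
  have hmem : ∀ s : ℂ, ‖s‖ ≤ 1 / 4 →
      ∀ i, ‖(z + s • EuclideanSpace.single a (1 : ℂ)) i‖ ≤ 1 / 2 := by
    intro s hs i
    rw [PiLp.add_apply]
    refine (norm_add_le _ _).trans ?_
    have : ‖(s • EuclideanSpace.single a (1 : ℂ) : Cn n) i‖ ≤ 1 / 4 := by
      by_cases hi : i = a
      · subst hi; simpa using hs
      · simp [hi]
    linarith [hz i]
  have h := norm_pderiv_le (isOpen_polydisk n)
    (differentiableOn_schwarzian (isOpen_polydisk n) hf hJ k i j) (i := a) (z := z)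
    (r := 1 / 4) (C := 12 * α) (by norm_num)
    (fun s hs i => (hmem s hs i).trans_lt (by norm_num))
    (fun s hs => norm_schwarzian_le hα hf hS (hmem s hs.le) k i j)
  linarith

/-- Here `n ≥ 2` is essential: `|n - 1| ≥ 1` lets the factor `n - 1` in `potential_eq` be dropped.
-/
theorem norm_potential_le (hn : 2 ≤ n) {α : ℝ} (hα : 0 ≤ α)
    (hf : ∀ l, DifferentiableOn ℂ (fun z => f z l) (polydisk n))
    (hJ : ∀ z ∈ polydisk n, jac f z ≠ 0)
    (hS : schwarzianNorm f ≤ ENNReal.ofReal α) {z : Cn n} (hz : ∀ i, ‖z i‖ ≤ 1 / 4)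
    (i j : Fin n) : ‖potential f i j z‖ ≤ n * (n * (12 * α) ^ 2) + n * (48 * α) := by
  have hz2 : ∀ i, ‖z i‖ ≤ 1 / 2 := fun i => (hz i).trans (by norm_num)
  have h := potential_eq (isOpen_polydisk n) hf hJ i j (z := z)
    (fun i => (hz i).trans_lt (by norm_num))
  have hn1 : (1 : ℝ) ≤ ‖(n : ℂ) - 1‖ := by
    have h2 : (2 : ℝ) ≤ n := by exact_mod_cast hn
    rw [show (n : ℂ) - 1 = ((n - 1 : ℝ) : ℂ) by push_cast; ring, Complex.norm_real,
      Real.norm_of_nonneg (by linarith)]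
    linarith
  have h1 : ‖((n : ℂ) - 1) * potential f i j z‖ ≤ n * (n * (12 * α) ^ 2) + n * (48 * α) := by
    rw [h]
    refine (norm_sub_le _ _).trans (add_le_add ?_ ?_)
    · have : ∀ k ∈ Finset.univ, ‖∑ r, schwarzian f k i r z * schwarzian f r k j z‖ ≤
          n * (12 * α) ^ 2 := fun k _ => by
        refine (norm_sum_le_of_le (n := fun _ => (12 * α) ^ 2) _ fun r _ => ?_).trans_eq (by simp)
        rw [norm_mul, sq]
        exact mul_le_mul (norm_schwarzian_le hα hf hS hz2 _ _ _)
          (norm_schwarzian_le hα hf hS hz2 _ _ _) (norm_nonneg _) (by positivity)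
      exact (norm_sum_le_of_le _ this).trans_eq (by simp)
    · refine (norm_sum_le_of_le (n := fun _ => 48 * α) _ fun k _ => ?_).trans_eq (by simp)
      exact norm_pderiv_schwarzian_le hα hf hJ hS hz _ _ _ _
  rw [norm_mul] at h1
  exact (le_mul_of_one_le_left (norm_nonneg _) hn1).trans h1

end Bounds

/-! ### The linear system along rays -/

section Rays

variable {n : ℕ} {f : Cn n → Cn n}

/-- Gronwall for `V - V 0`, whose derivative is at most `K ‖V - V 0‖ + K`, gives `e^K - 1 ≤ 2K`. The
Gronwall bound has a separate form for `K = 0`. -/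
theorem norm_sub_le_of_linear_growth {E : Type*} [NormedAddCommGroup E] [NormedSpace ℝ E]
    {V V' : ℝ → E} {K : ℝ} (hK0 : 0 ≤ K) (hK1 : K ≤ 1)
    (hV : ∀ t ∈ Icc (0 : ℝ) 1, HasDerivAt V (V' t) t)
    (hV' : ∀ t ∈ Icc (0 : ℝ) 1, ‖V' t‖ ≤ K * ‖V t‖) (h0 : ‖V 0‖ ≤ 1) :
    ‖V 1 - V 0‖ ≤ 2 * K := by
  rcases hK0.eq_or_lt with rfl | hK
  · have := norm_le_gronwallBound_of_norm_deriv_right_le (f := fun t => V t - V 0) (f' := V')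
      (δ := 0) (K := 0) (ε := 0) (a := 0) (b := 1)
      (fun t ht => ((hV t ht).sub_const _).continuousAt.continuousWithinAt)
      (fun t ht => ((hV t (Ico_subset_Icc_self ht)).sub_const _).hasDerivWithinAt)
      (by simp) (fun t ht => by simpa using hV' t (Ico_subset_Icc_self ht)) 1 (by simp)
    simpa [gronwallBound_K0] using this
  · have := norm_le_gronwallBound_of_norm_deriv_right_le (f := fun t => V t - V 0) (f' := V')
      (δ := 0) (K := K) (ε := K) (a := 0) (b := 1)
      (fun t ht => ((hV t ht).sub_const _).continuousAt.continuousWithinAt)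
      (fun t ht => ((hV t (Ico_subset_Icc_self ht)).sub_const _).hasDerivWithinAt)
      (by simp) (fun t ht => by
        refine (hV' t (Ico_subset_Icc_self ht)).trans ?_
        have h1 : ‖V t‖ ≤ ‖V t - V 0‖ + 1 := by
          have := norm_add_le (V t - V 0) (V 0)
          rw [sub_add_cancel] at this
          linarith
        nlinarith) 1 (by simp)
    rw [gronwallBound_of_K_ne_0 hK.ne'] at this
    simp only [sub_zero, mul_one, zero_mul, zero_add, div_self hK.ne', one_mul] at this
    refine this.trans ((le_abs_self _).trans ?_)
    have h2 := Real.abs_exp_sub_one_le (x := K) (by rwa [abs_of_pos hK])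
    rwa [abs_of_pos hK] at h2

/-- `φ` solves the system `∂_i ∂_j φ = ∑ k, Γ^k_{ij} ∂_k φ` satisfied by the components of `f`. -/
def IsAffineFor (f : Cn n → Cn n) (φ : Cn n → ℂ) : Prop :=
  DifferentiableOn ℂ φ (polydisk n) ∧ ∀ z ∈ polydisk n, ∀ i j,
    pderiv i (pderiv j φ) z = ∑ k, connection f k i j z * pderiv k φ z

noncomputable section

/-- The partial derivative of `φ` twisted by the logarithmic derivative of `J_f`. -/
def twistedDeriv (f : Cn n → Cn n) (φ : Cn n → ℂ) (i : Fin n) (z : Cn n) : ℂ :=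
  pderiv i φ z - logJac f i z * φ z

end

/-- The twisted derivative is `u⁻¹ ∂_i(uφ)`. The uncontrolled `p` enters only through the scalar
term `p_j` times the unknown, as it does in `∂_j φ = twistedDeriv f φ j + p_j φ`; multiplication by
`u` removes both. -/
theorem pderiv_twistedDeriv (hf : ∀ l, DifferentiableOn ℂ (fun z => f z l) (polydisk n))
    (hJ : ∀ z ∈ polydisk n, jac f z ≠ 0) {φ : Cn n → ℂ} (hφ : IsAffineFor f φ) {z : Cn n}
    (hz : z ∈ polydisk n) (i j : Fin n) :
    pderiv j (twistedDeriv f φ i) z = logJac f j z * twistedDeriv f φ i z +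
      (∑ k, schwarzian f k j i z * twistedDeriv f φ k z + potential f j i z * φ z) := by
  have hU := isOpen_polydisk n
  have hL := (differentiableOn_logJac hU hf hJ i).differentiableAt (hU.mem_nhds hz)
  have hφ0 := hφ.1.differentiableAt (hU.mem_nhds hz)
  have hφ1 := (differentiableOn_pderiv hU hφ.1 i).differentiableAt (hU.mem_nhds hz)
  have h1 : pderiv j (twistedDeriv f φ i) z = ∑ k, connection f k j i z * pderiv k φ z -
      (pderiv j (logJac f i) z * φ z + logJac f i z * pderiv j φ z) := by
    rw [← hφ.2 z hz, ← pderiv_mul hL hφ0]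
    exact pderiv_sub hφ1 (hL.fun_mul hφ0) j
  have h2 : ∑ k, connection f k j i z * pderiv k φ z =
      ∑ k, schwarzian f k j i z * pderiv k φ z + logJac f i z * pderiv j φ z +
        logJac f j z * pderiv i φ z := by
    simp only [connection_eq, add_mul, Finset.sum_add_distrib, ite_mul, zero_mul,
      Finset.sum_ite_eq', Finset.mem_univ, if_true]
    ring
  have h3 : ∑ k, schwarzian f k j i z * twistedDeriv f φ k z =
      ∑ k, schwarzian f k j i z * pderiv k φ z -
        (∑ k, schwarzian f k j i z * logJac f k z) * φ z := by
    simp only [twistedDeriv, mul_sub, Finset.sum_sub_distrib, Finset.sum_mul, mul_assoc]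
  rw [h1, h2, h3]
  simp only [twistedDeriv, potential]
  ring

theorem smul_mem_polydisk {z : Cn n} (hz : ∀ i, ‖z i‖ ≤ 1 / 4) {t : ℂ} (ht : t ∈ ball (0 : ℂ) 2) :
    t • z ∈ polydisk n := fun i => by
  rw [PiLp.smul_apply, norm_smul]
  rw [mem_ball_zero_iff] at ht
  nlinarith [hz i, norm_nonneg t, norm_nonneg (z i)]

theorem hasDerivAt_ray {φ : Cn n → ℂ} {z : Cn n} {t : ℂ} (hφ : DifferentiableAt ℂ φ (t • z)) :
    HasDerivAt (fun s : ℂ => φ (s • z)) (∑ j, z j * pderiv j φ (t • z)) t := by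
  rw [← fderiv_apply_eq_sum]
  have := hasDerivAt_comp_line (z := 0) (v := z) (t := t) (h := φ) (by simpa using hφ.hasFDerivAt)
  simpa using this

/-- The branch of `(J_f(0) / J_f)^{1/(n+1)}` along the complex line through `z`. -/
theorem exists_multiplier (hf : ∀ l, DifferentiableOn ℂ (fun z => f z l) (polydisk n))
    (hJ : ∀ z ∈ polydisk n, jac f z ≠ 0) {z : Cn n} (hz : ∀ i, ‖z i‖ ≤ 1 / 4) :
    ∃ u : ℂ → ℂ, u 0 = 1 ∧ ∀ t ∈ ball (0 : ℂ) 2, u t ≠ 0 ∧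
      HasDerivAt u (-(∑ j, z j * logJac f j (t • z)) * u t) t := by
  have hU := isOpen_polydisk n
  have hq : DifferentiableOn ℂ (fun t : ℂ => ∑ j, z j * logJac f j (t • z)) (ball 0 2) := by
    intro t ht
    refine (DifferentiableAt.fun_sum fun j _ => ?_).differentiableWithinAt
    exact (hasDerivAt_ray ((differentiableOn_logJac hU hf hJ j).differentiableAt
      (hU.mem_nhds (smul_mem_polydisk hz ht)))).differentiableAt.const_mul _
  -- A primitive on the disc plays the role of `log J_f / (n+1)` along the line. The radius `2`
  -- leaves room around the segment `[0, 1]`.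
  obtain ⟨Q, hQ⟩ := hq.isExactOn_ball
  refine ⟨fun t => Complex.exp (Q 0 - Q t), by simp, fun t ht => ⟨Complex.exp_ne_zero _, ?_⟩⟩
  have := ((hQ t ht).const_sub (Q 0)).cexp
  simpa [mul_comm] using this

/-- Gronwall along the segment from `0` to `z`. The multiplier `w = u(1)` depends on `f` and `z` but
not on `φ`, so it cancels in quotients of solutions. In the constant, `n * B + B₀` bounds the
derivatives of the twisted components, `1` that of the function itself, and the outer `n` counts the
directions. -/
theorem exists_approx_initial_values
    (hf : ∀ l, DifferentiableOn ℂ (fun z => f z l) (polydisk n))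
    (hJ : ∀ z ∈ polydisk n, jac f z ≠ 0) {B B₀ : ℝ} (hB0 : 0 ≤ B) (hB₀0 : 0 ≤ B₀)
    (hB : ∀ z : Cn n, (∀ i, ‖z i‖ ≤ 1 / 4) → ∀ k i j, ‖schwarzian f k i j z‖ ≤ B)
    (hB₀ : ∀ z : Cn n, (∀ i, ‖z i‖ ≤ 1 / 4) → ∀ i j, ‖potential f i j z‖ ≤ B₀)
    {ρ : ℝ} (hρ0 : 0 ≤ ρ) (hρ : ρ ≤ 1 / 4) (hρ1 : ρ * (n * (n * B + B₀ + 1)) ≤ 1)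
    {z : Cn n} (hz : ∀ i, ‖z i‖ ≤ ρ) :
    ∃ w : ℂ, w ≠ 0 ∧ ∀ φ : Cn n → ℂ, IsAffineFor f φ → ‖φ 0‖ ≤ 1 →
      (∀ i, ‖twistedDeriv f φ i 0‖ ≤ 1) →
      ‖w * φ z - φ 0‖ ≤ 2 * (ρ * (n * (n * B + B₀ + 1))) ∧
      ∀ i, ‖w * twistedDeriv f φ i z - twistedDeriv f φ i 0‖ ≤
        2 * (ρ * (n * (n * B + B₀ + 1))) := by
  have hU := isOpen_polydisk n
  have hz4 : ∀ i, ‖z i‖ ≤ 1 / 4 := fun i => (hz i).trans hρ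
  obtain ⟨u, hu0, hu⟩ := exists_multiplier hf hJ hz4
  refine ⟨u 1, (hu 1 (by simp)).1, fun φ hφ h0 h1 => ?_⟩
  have hball : ∀ t ∈ Icc (0 : ℝ) 1, (t : ℂ) ∈ ball (0 : ℂ) 2 := fun t ht => by
    rw [mem_ball_zero_iff, Complex.norm_real, Real.norm_of_nonneg ht.1]
    linarith [ht.2]
  set V : ℝ → ℂ × (Fin n → ℂ) := fun t =>
    (u t * φ ((t : ℂ) • z), fun i => u t * twistedDeriv f φ i ((t : ℂ) • z)) with hVdef
  -- No `logJac` appears: the derivative of `u` has cancelled it, and only the bounded coefficients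
  -- remain.
  set V' : ℝ → ℂ × (Fin n → ℂ) := fun t =>
    (∑ j, z j * (V t).2 j, fun i => ∑ j, z j *
      (∑ k, schwarzian f k j i ((t : ℂ) • z) * (V t).2 k +
        potential f j i ((t : ℂ) • z) * (V t).1)) with hV'def
  have hTd : ∀ i, DifferentiableOn ℂ (twistedDeriv f φ i) (polydisk n) := fun i =>
    (differentiableOn_pderiv hU hφ.1 i).sub ((differentiableOn_logJac hU hf hJ i).mul hφ.1)
  have hV : ∀ t ∈ Icc (0 : ℝ) 1, HasDerivAt V (V' t) t := by
    intro t ht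
    have hmem := smul_mem_polydisk hz4 (hball t ht)
    obtain ⟨-, hut⟩ := hu t (hball t ht)
    refine HasDerivAt.prodMk ?_ (hasDerivAt_pi.2 fun i => ?_)
    · have h := (hut.mul (hasDerivAt_ray (hφ.1.differentiableAt (hU.mem_nhds hmem)))).comp_ofReal
      refine h.congr_deriv ?_
      simp only [hVdef, twistedDeriv, mul_sub, Finset.sum_sub_distrib, Finset.mul_sum,
        neg_mul, Finset.sum_mul]
      rw [neg_add_eq_sub]
      congr 1
      all_goals exact Finset.sum_congr rfl fun j _ => by ring
    · have h := (hut.mul (hasDerivAt_ray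
        ((hTd i).differentiableAt (hU.mem_nhds hmem)))).comp_ofReal
      refine h.congr_deriv ?_
      simp only [pderiv_twistedDeriv hf hJ hφ hmem i]
      have e : ∀ j, z j * (∑ k, schwarzian f k j i ((t : ℂ) • z) * (V t).2 k +
          potential f j i ((t : ℂ) • z) * (V t).1) =
          u t * (z j * (∑ k, schwarzian f k j i ((t : ℂ) • z) *
            twistedDeriv f φ k ((t : ℂ) • z) + potential f j i ((t : ℂ) • z) *
              φ ((t : ℂ) • z))) := fun j => by
        have e1 : ∑ k, schwarzian f k j i ((t : ℂ) • z) * (V t).2 k =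
            u t * ∑ k, schwarzian f k j i ((t : ℂ) • z) * twistedDeriv f φ k ((t : ℂ) • z) := by
          rw [Finset.mul_sum]
          exact Finset.sum_congr rfl fun k _ => by simp only [hVdef]; ring
        rw [e1]
        simp only [hVdef]
        ring
      simp only [e, ← Finset.mul_sum]
      have e2 : ∀ (a : Fin n → ℂ) (x : ℂ), ∑ j, z j * (logJac f j ((t : ℂ) • z) * x + a j) =
          (∑ j, z j * logJac f j ((t : ℂ) • z)) * x + ∑ j, z j * a j := fun a x => by
        rw [Finset.sum_mul, ← Finset.sum_add_distrib]
        exact Finset.sum_congr rfl fun j _ => by ring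
      rw [e2]
      ring
  have hV' : ∀ t ∈ Icc (0 : ℝ) 1, ‖V' t‖ ≤ ρ * (n * (n * B + B₀ + 1)) * ‖V t‖ := by
    intro t ht
    have htz : ∀ i, ‖((t : ℂ) • z) i‖ ≤ 1 / 4 := fun i => by
      rw [PiLp.smul_apply, norm_smul, Complex.norm_real, Real.norm_of_nonneg ht.1]
      nlinarith [hz4 i, ht.1, ht.2, norm_nonneg (z i)]
    have hN := norm_nonneg (V t)
    have hfst : ‖(V t).1‖ ≤ ‖V t‖ := norm_fst_le _
    have hsnd : ∀ i, ‖(V t).2 i‖ ≤ ‖V t‖ := fun i => (norm_le_pi_norm _ i).trans (norm_snd_le _)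
    have hsum : ∀ (a : Fin n → ℂ) (c : ℝ), c ≤ n * B + B₀ + 1 → (∀ j, ‖a j‖ ≤ c * ‖V t‖) →
        ‖∑ j, z j * a j‖ ≤ ρ * (n * (n * B + B₀ + 1)) * ‖V t‖ := fun a c hc ha => by
      refine (norm_sum_le_of_le (n := fun _ => ρ * ((n * B + B₀ + 1) * ‖V t‖)) _
        fun j _ => ?_).trans_eq ?_
      · rw [norm_mul]
        exact mul_le_mul (hz j) ((ha j).trans (mul_le_mul_of_nonneg_right hc hN))
          (norm_nonneg _) hρ0
      · simp; ring
    have hnB : 0 ≤ n * B := by positivity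
    have hK : 0 ≤ ρ * (n * (n * B + B₀ + 1)) * ‖V t‖ := by positivity
    refine norm_prod_le_iff.2 ⟨hsum _ 1 (by linarith) fun j => by simpa using hsnd j,
      (pi_norm_le_iff_of_nonneg hK).2 fun i => hsum _ (n * B + B₀) (by linarith) fun j => ?_⟩
    rw [add_mul]
    refine (norm_add_le _ _).trans (add_le_add ?_ ?_)
    · refine (norm_sum_le_of_le (n := fun _ => B * ‖V t‖) _ fun k _ => ?_).trans_eq (by simp; ring)
      rw [norm_mul]
      exact mul_le_mul (hB _ htz _ _ _) (hsnd k) (norm_nonneg _) hB0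
    · rw [norm_mul]
      exact mul_le_mul (hB₀ _ htz _ _) hfst (norm_nonneg _) hB₀0
  have hV0 : V 0 = (φ 0, fun i => twistedDeriv f φ i 0) := by
    simp [hVdef, hu0]
  have hV1 : V 1 = (u 1 * φ z, fun i => u 1 * twistedDeriv f φ i z) := by
    simp [hVdef]
  have key := norm_sub_le_of_linear_growth (by positivity) hρ1 hV hV' (by
    rw [hV0]
    exact norm_prod_le_iff.2 ⟨h0, (pi_norm_le_iff_of_nonneg zero_le_one).2 h1⟩)
  rw [hV0, hV1] at key
  exact ⟨(norm_fst_le _).trans key, fun i =>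
    (norm_le_pi_norm (fun i => u 1 * twistedDeriv f φ i z - twistedDeriv f φ i 0) i).trans
      ((norm_snd_le _).trans key)⟩

end Rays

/-! ### Members of the family and their Möbius transforms -/

section Family

variable {n : ℕ} {U : Set (Cn n)} {f : Cn n → Cn n}

theorem zero_mem_polydisk : (0 : Cn n) ∈ polydisk n := fun i => by simp

theorem differentiableAt_apply {z : Cn n} (hf : DifferentiableAt ℂ f z) (l : Fin n) :
    DifferentiableAt ℂ (fun w => f w l) z :=
  (EuclideanSpace.proj (𝕜 := ℂ) l).differentiableAt.comp z hf

theorem fderiv_apply_coord {z : Cn n} (hf : DifferentiableAt ℂ f z) (v : Cn n) (l : Fin n) :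
    fderiv ℂ (fun w => f w l) z v = (fderiv ℂ f z v) l := by
  have h := ((EuclideanSpace.proj (𝕜 := ℂ) l : Cn n →L[ℂ] ℂ).hasFDerivAt (x := f z)).comp z
    hf.hasFDerivAt
  have h' : HasFDerivAt (fun w => f w l)
      ((EuclideanSpace.proj (𝕜 := ℂ) l : Cn n →L[ℂ] ℂ).comp (fderiv ℂ f z)) z := h
  rw [h'.fderiv]
  rfl

theorem LocallyBiholomorphicOn.differentiableAt (h : LocallyBiholomorphicOn f U) {z : Cn n}
    (hz : z ∈ U) : DifferentiableAt ℂ f z := by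
  obtain ⟨e, hze, -, hfe, he, -⟩ := h z hz
  have hn := e.open_source.mem_nhds hze
  exact (he.differentiableAt hn).congr_of_eventuallyEq (hfe.eventuallyEq_of_mem hn)

/-- By the chain rule the derivative of the local inverse is a left inverse of `Df`, so `Df` has no
kernel. -/
theorem LocallyBiholomorphicOn.jac_ne_zero (h : LocallyBiholomorphicOn f U) {z : Cn n}
    (hz : z ∈ U) : jac f z ≠ 0 := by
  intro h0
  obtain ⟨v, hv, hMv⟩ := Matrix.exists_mulVec_eq_zero_iff.2 h0
  have hd := h.differentiableAt hz
  obtain ⟨e, hze, -, hfe, -, hs⟩ := h z hz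
  have hn := e.open_source.mem_nhds hze
  have hs' : DifferentiableAt ℂ e.symm (f z) := by
    rw [hfe hze]
    exact hs.differentiableAt (e.open_target.mem_nhds (e.map_source hze))
  have hcomp : HasFDerivAt (e.symm ∘ f) ((fderiv ℂ e.symm (f z)).comp (fderiv ℂ f z)) z :=
    hs'.hasFDerivAt.comp z hd.hasFDerivAt
  have hid : HasFDerivAt (e.symm ∘ f) (ContinuousLinearMap.id ℂ (Cn n)) z := by
    refine (hasFDerivAt_id z).congr_of_eventuallyEq ?_
    filter_upwards [hn] with y hy
    rw [Function.comp_apply, hfe hy, e.left_inv hy, id]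
  have hker : fderiv ℂ f z (WithLp.toLp 2 v) = 0 := by
    ext l
    rw [← fderiv_apply_coord hd, fderiv_apply_eq_sum]
    have := congrFun hMv l
    simp only [Matrix.mulVec, dotProduct] at this
    simpa [mul_comm, jacMatrix] using this
  have h1 := congrArg (fun L : Cn n →L[ℂ] Cn n => L (WithLp.toLp 2 v)) (hcomp.unique hid)
  simp only [ContinuousLinearMap.comp_apply, hker, map_zero, ContinuousLinearMap.id_apply] at h1
  apply hv
  ext i
  exact (congrArg (fun x : Cn n => x i) h1).symm

theorem pderiv_apply_of_fderiv_eq_id (hd : DifferentiableAt ℂ f 0)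
    (h : fderiv ℂ f 0 = ContinuousLinearMap.id ℂ (Cn n)) (i l : Fin n) :
    pderiv i (fun w => f w l) 0 = if l = i then 1 else 0 := by
  rw [pderiv, fderiv_apply_coord hd, h]
  simp

theorem jacMatrix_eq_one (h : ∀ i l, pderiv i (fun w => f w l) 0 = if l = i then 1 else 0) :
    jacMatrix f 0 = 1 := by
  ext l i
  rw [jacMatrix, Matrix.of_apply, h, Matrix.one_apply]

/-- The gradient of the Jacobian at a point where the derivative is the identity. -/
theorem pderiv_jac_zero (hU : IsOpen U) (h0 : (0 : Cn n) ∈ U)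
    (hf : ∀ l, DifferentiableOn ℂ (fun z => f z l) U)
    (h : ∀ i l, pderiv i (fun w => f w l) 0 = if l = i then 1 else 0) (i : Fin n) :
    pderiv i (jac f) 0 = ∑ m, pderiv i (pderiv m (fun w => f w m)) 0 := by
  have hM := jacMatrix_eq_one h
  have hJ : jac f 0 = 1 := by rw [jac, hM, Matrix.det_one]
  have hJ0 : jac f 0 ≠ 0 := by rw [hJ]; exact one_ne_zero
  have h1 := sum_connection hU hf i h0 hJ0
  rw [logJac, hJ, div_one, ← mul_assoc, mul_one_div_cancel (Nat.cast_add_one_ne_zero n),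
    one_mul] at h1
  rw [← h1]
  simp only [connection, hM, inv_one, Matrix.one_apply, mul_ite, mul_one, mul_zero,
    Finset.sum_ite_eq, Finset.mem_univ, if_true]

section Mobius

variable (a : Cn n)

theorem differentiableOn_mobiusDenom (hf : ∀ l, DifferentiableOn ℂ (fun z => f z l) U) :
    DifferentiableOn ℂ (fun z => mobiusDenom a (f z)) U :=
  (DifferentiableOn.fun_sum fun l _ => (hf l).const_mul (a l)).const_add 1

theorem pderiv_mobiusDenom {z : Cn n} (hf : ∀ l, DifferentiableAt ℂ (fun z => f z l) z)
    (i : Fin n) : pderiv i (fun z => mobiusDenom a (f z)) z =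
      ∑ l, a l * pderiv i (fun w => f w l) z := by
  have h1 : pderiv i (fun z => mobiusDenom a (f z)) z =
      pderiv i (fun z => ∑ l, a l * f z l) z := by
    rw [pderiv, pderiv]
    simp only [mobiusDenom, fderiv_const_add]
  rw [h1, pderiv_sum fun l _ => (hf l).const_mul (a l)]
  exact Finset.sum_congr rfl fun l _ => pderiv_const_mul _ (hf l) i

theorem isAffineFor_apply (hf : ∀ l, DifferentiableOn ℂ (fun z => f z l) (polydisk n))
    (hJ : ∀ z ∈ polydisk n, jac f z ≠ 0) (l : Fin n) : IsAffineFor f (fun z => f z l) :=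
  ⟨hf l, fun z hz i j => hessian_eq (hJ z hz) l i j⟩

/-- The system is linear without zeroth order term, so it is solved by constants as well as by the
components of `f`. -/
theorem isAffineFor_mobiusDenom (hf : ∀ l, DifferentiableOn ℂ (fun z => f z l) (polydisk n))
    (hJ : ∀ z ∈ polydisk n, jac f z ≠ 0) : IsAffineFor f (fun z => mobiusDenom a (f z)) := by
  have hU := isOpen_polydisk n
  refine ⟨differentiableOn_mobiusDenom a hf, fun z hz i j => ?_⟩
  have hd : ∀ y ∈ polydisk n, ∀ l, DifferentiableAt ℂ (fun z => f z l) y := fun y hy l =>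
    (hf l).differentiableAt (hU.mem_nhds hy)
  have h1 : EqOn (pderiv j fun z => mobiusDenom a (f z))
      (fun y => ∑ l, a l * pderiv j (fun w => f w l) y) (polydisk n) := fun y hy =>
    pderiv_mobiusDenom a (hd y hy) j
  have h2 := fun l => (differentiableOn_pderiv hU (hf l) j).differentiableAt (hU.mem_nhds hz)
  rw [pderiv_congr hU h1 i hz, pderiv_sum fun l _ => (h2 l).const_mul (a l)]
  simp only [pderiv_mobiusDenom a (hd z hz), Finset.mul_sum]
  rw [Finset.sum_comm]
  refine Finset.sum_congr rfl fun l _ => ?_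
  rw [pderiv_const_mul _ (h2 l), hessian_eq (hJ z hz), Finset.mul_sum]
  exact Finset.sum_congr rfl fun k _ => by ring

theorem mobius_apply (w : Cn n) (l : Fin n) : mobius a w l = w l / mobiusDenom a w := by
  rw [mobius, PiLp.smul_apply, smul_eq_mul, div_eq_inv_mul]

theorem mobiusDenom_zero : mobiusDenom a (0 : Cn n) = 1 := by simp [mobiusDenom]

theorem isOpen_mobiusDenom_ne_zero (hU : IsOpen U)
    (hf : ∀ l, DifferentiableOn ℂ (fun z => f z l) U) :
    IsOpen (U ∩ {z | mobiusDenom a (f z) ≠ 0}) :=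
  (differentiableOn_mobiusDenom a hf).continuousOn.isOpen_inter_preimage hU isOpen_ne

theorem differentiableOn_mobius (hU : IsOpen U)
    (hf : ∀ l, DifferentiableOn ℂ (fun z => f z l) U) (l : Fin n) :
    DifferentiableOn ℂ (fun z => mobius a (f z) l) (U ∩ {z | mobiusDenom a (f z) ≠ 0}) := by
  intro z hz
  simp only [mobius_apply]
  exact (differentiableAt_div ((hf l).differentiableAt (hU.mem_nhds hz.1))
    ((differentiableOn_mobiusDenom a hf).differentiableAt
      (hU.mem_nhds hz.1)) hz.2).differentiableWithinAt

/-- The effect of `T_a` on the gradient of the Jacobian at the origin. -/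
theorem grad_jac_mobius (hU : IsOpen U) (hU0 : (0 : Cn n) ∈ U)
    (hf : ∀ l, DifferentiableOn ℂ (fun z => f z l) U) (hf0 : f 0 = 0)
    (h : ∀ i l, pderiv i (fun w => f w l) 0 = if l = i then 1 else 0) :
    grad (jac fun z => mobius a (f z)) 0 = grad (jac f) 0 - ((n : ℂ) + 1) • a := by
  set W := U ∩ {z | mobiusDenom a (f z) ≠ 0} with hW
  set g := fun z => mobius a (f z) with hg
  set D := fun z => mobiusDenom a (f z) with hD
  have hWo : IsOpen W := isOpen_mobiusDenom_ne_zero a hU hf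
  have hD0 : D 0 = 1 := by simp only [hD, hf0, mobiusDenom_zero]
  have hW0 : (0 : Cn n) ∈ W := ⟨hU0, by change D 0 ≠ 0; rw [hD0]; exact one_ne_zero⟩
  have hgd : ∀ l, DifferentiableOn ℂ (fun z => g z l) W := differentiableOn_mobius a hU hf
  have hDd : DifferentiableOn ℂ D W := (differentiableOn_mobiusDenom a hf).mono inter_subset_left
  have hg0 : ∀ l, g 0 l = 0 := fun l => by simp only [hg, mobius_apply, hf0]; simp
  -- Differentiating the product `f_l = g_l D` twice avoids second derivatives of a quotient. The
  -- correction `δ_{lm} a_i + δ_{li} a_m`, summed over `l = m`, is `(n+1) a_i`.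
  have hmul : ∀ l, EqOn (fun w => f w l) (fun w => g w l * D w) W := fun l w hw => by
    simp only [hg, hD, mobius_apply]
    rw [div_mul_cancel₀ _ hw.2]
  have hfirst : ∀ m l, EqOn (pderiv m fun w => f w l)
      (fun w => pderiv m (fun w => g w l) w * D w + g w l * pderiv m D w) W := fun m l w hw => by
    rw [pderiv_congr hWo (hmul l) m hw]
    exact pderiv_mul ((hgd l).differentiableAt (hWo.mem_nhds hw))
      (hDd.differentiableAt (hWo.mem_nhds hw)) m
  have hg1 : ∀ i l, pderiv i (fun w => g w l) 0 = if l = i then 1 else 0 := fun i l => by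
    rw [← h i l, hfirst i l hW0]
    simp only [hD0, hg0]
    ring
  have hD1 : ∀ i, pderiv i D 0 = a i := fun i => by
    rw [pderiv_mobiusDenom a fun l => (hf l).differentiableAt (hU.mem_nhds hU0)]
    simp [h]
  have hn0 := hWo.mem_nhds hW0
  have hsecond : ∀ i m l, pderiv i (pderiv m fun w => f w l) 0 =
      pderiv i (pderiv m fun w => g w l) 0 + (if l = m then 1 else 0) * a i +
        (if l = i then 1 else 0) * a m := fun i m l => by
    have d1 := (differentiableOn_pderiv hWo (hgd l) m).differentiableAt hn0
    have d2 := hDd.differentiableAt hn0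
    have d3 := (hgd l).differentiableAt hn0
    have d4 := (differentiableOn_pderiv hWo hDd m).differentiableAt hn0
    rw [pderiv_congr hWo (hfirst m l) i hW0, pderiv_add (d1.fun_mul d2) (d3.fun_mul d4),
      pderiv_mul d1 d2, pderiv_mul d3 d4, hD0, hg0, hg1, hg1, hD1, hD1]
    ring
  ext i
  have e1 := pderiv_jac_zero hU hU0 hf h i
  have e2 := pderiv_jac_zero hWo hW0 hgd hg1 i
  simp only [hsecond, Finset.sum_add_distrib, ← e2, if_true, one_mul, Finset.sum_const,
    Finset.card_univ, Fintype.card_fin, nsmul_eq_mul, ite_mul, zero_mul, Finset.sum_ite_eq',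
    Finset.mem_univ] at e1
  simp only [grad, PiLp.sub_apply, PiLp.smul_apply, smul_eq_mul, e1]
  ring

end Mobius

end Family

/-! ### The covering theorem -/

section Covering

variable {n : ℕ} {f : Cn n → Cn n}

theorem norm_le_sum_norm (x : Cn n) : ‖x‖ ≤ ∑ i, ‖x i‖ := by
  have hx : x = ∑ i, x i • EuclideanSpace.single i (1 : ℂ) := by
    ext k; simp [Finset.sum_apply, Pi.single_apply]
  conv_lhs => rw [hx]
  exact (norm_sum_le _ _).trans_eq (by simp [norm_smul])

/-- A map whose partial derivatives are close to those of the identity covers a ball. -/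
theorem closedBall_subset_image {g : Cn n → Cn n} {ρ η : ℝ} (hρ : 0 ≤ ρ)
    (hη : n * (n * η) ≤ 1 / 2) (hg0 : g 0 = 0)
    (hg : ∀ z ∈ closedBall (0 : Cn n) ρ, DifferentiableAt ℂ g z)
    (hb : ∀ z ∈ closedBall (0 : Cn n) ρ, ∀ i l,
      ‖pderiv i (fun w => g w l) z - if l = i then 1 else 0‖ ≤ η) :
    closedBall (0 : Cn n) (ρ / 2) ⊆ g '' closedBall (0 : Cn n) ρ := by
  have hop : ∀ z ∈ closedBall (0 : Cn n) ρ,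
      ‖fderiv ℂ g z - ContinuousLinearMap.id ℂ (Cn n)‖ ≤ 1 / 2 := by
    intro z hz
    refine ContinuousLinearMap.opNorm_le_bound _ (by norm_num) fun v => ?_
    refine (norm_le_sum_norm _).trans ?_
    have hl : ∀ l ∈ Finset.univ, ‖((fderiv ℂ g z - ContinuousLinearMap.id ℂ (Cn n)) v) l‖ ≤
        n * (η * ‖v‖) := fun l _ => by
      have e : ((fderiv ℂ g z - ContinuousLinearMap.id ℂ (Cn n)) v) l =
          ∑ i, v i * (pderiv i (fun w => g w l) z - if l = i then 1 else 0) := by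
        simp only [mul_sub, Finset.sum_sub_distrib, mul_ite, mul_one, mul_zero,
          Finset.sum_ite_eq, Finset.mem_univ, if_true, ← fderiv_apply_eq_sum]
        rw [fderiv_apply_coord (hg z hz)]
        rfl
      rw [e]
      refine (norm_sum_le_of_le (n := fun _ => η * ‖v‖) _ fun i _ => ?_).trans_eq (by simp)
      rw [norm_mul, mul_comm]
      have := hb z hz i l
      exact mul_le_mul this (PiLp.norm_apply_le v i) (norm_nonneg _) ((norm_nonneg _).trans this)
    refine (Finset.sum_le_sum hl).trans ?_
    simp only [Finset.sum_const, Finset.card_univ, Fintype.card_fin, nsmul_eq_mul]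
    nlinarith [norm_nonneg v]
  have happrox : ApproximatesLinearOn g (ContinuousLinearMap.id ℂ (Cn n)) (closedBall 0 ρ)
      (1 / 2) := fun x hx y hy => by
    have := Convex.norm_image_sub_le_of_norm_hasFDerivWithin_le' (𝕜 := ℂ) (f := g)
      (fun z hz => (hg z hz).hasFDerivAt.hasFDerivWithinAt) hop (convex_closedBall 0 ρ) hy hx
    simpa using this
  -- The identity is its own right inverse with constant `1`, so the covered radius is `(1 - 1/2)
  -- ρ`.
  have h := happrox.surjOn_closedBall_of_nonlinearRightInverse
    ⟨id, 1, fun y => by simp, fun y => rfl⟩ hρ (subset_refl _)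
  rw [hg0] at h
  have hr : ((1 : NNReal) : ℝ)⁻¹ - ((1 / 2 : NNReal) : ℝ) = 1 / 2 := by norm_num
  have hr' : ρ / 2 = (((1 : NNReal) : ℝ)⁻¹ - ((1 / 2 : NNReal) : ℝ)) * ρ := by rw [hr]; ring
  rw [hr']
  exact h

/-- The numerator of the difference is at most `(3/2 + 3/2 + 1/2) ε` and `|d|² ≥ 1/4`, which gives
`14 ε`. -/
theorem norm_quotient_derivative_sub_le {ε : ℝ} (hε : ε ≤ 1 / 2) {x y d e δ : ℂ}
    (hδ : ‖δ‖ ≤ 1) (hd : ‖d - 1‖ ≤ ε) (hx : ‖x - δ‖ ≤ ε) (hy : ‖y‖ ≤ ε) (he : ‖e‖ ≤ ε) :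
    ‖(x * d - y * e) / d ^ 2 - δ‖ ≤ 20 * ε := by
  have hε0 : 0 ≤ ε := (norm_nonneg _).trans hd
  have hd2 : 1 / 2 ≤ ‖d‖ := by
    have := norm_sub_norm_le (1 : ℂ) (1 - d)
    rw [norm_one, norm_sub_rev, sub_sub_cancel] at this
    linarith
  have hd3 : ‖d‖ ≤ 3 / 2 := by
    have := norm_add_le (d - 1) 1
    rw [sub_add_cancel, norm_one] at this
    linarith
  have hd0 : d ≠ 0 := fun h => by rw [h, norm_zero] at hd2; linarith
  have e1 : (x * d - y * e) / d ^ 2 - δ =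
      ((x - δ) * d - δ * (d - 1) * d - y * e) / d ^ 2 := by
    field_simp; ring
  rw [e1, norm_div, norm_pow, div_le_iff₀ (by positivity)]
  have h1 : ‖(x - δ) * d‖ ≤ ε * (3 / 2) := by
    rw [norm_mul]; exact mul_le_mul hx hd3 (norm_nonneg _) hε0
  have h2 : ‖δ * (d - 1) * d‖ ≤ 1 * ε * (3 / 2) := by
    rw [norm_mul, norm_mul]
    exact mul_le_mul (mul_le_mul hδ hd (norm_nonneg _) zero_le_one) hd3 (norm_nonneg _)
      (by positivity)
  have h3 : ‖y * e‖ ≤ ε * (1 / 2) := by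
    rw [norm_mul]; exact mul_le_mul hy (he.trans hε) (norm_nonneg _) hε0
  have h4 := norm_sub_le ((x - δ) * d - δ * (d - 1) * d) (y * e)
  have h5 := norm_sub_le ((x - δ) * d) (δ * (d - 1) * d)
  have h6 : 1 / 4 ≤ ‖d‖ ^ 2 := by nlinarith
  nlinarith

/-- The covering theorem for the normalized Möbius transforms of members of `F_α`. -/
theorem exists_covering_radius (hn : 2 ≤ n) {α : ℝ} (hα : 0 ≤ α) :
    ∃ s : ℝ, 0 < s ∧ ∀ f ∈ family n α, ∀ a : Cn n, grad (jac f) 0 = ((n : ℂ) + 1) • a →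
      ∀ y ∈ ball (0 : Cn n) s, ∃ z ∈ polydisk n, mobiusDenom a (f z) ≠ 0 ∧ mobius a (f z) = y := by
  set B : ℝ := 12 * α with hBdef
  set B₀ : ℝ := n * (n * (12 * α) ^ 2) + n * (48 * α) with hB₀def
  have hB0 : 0 ≤ B := by positivity
  have hB₀0 : 0 ≤ B₀ := by positivity
  set C : ℝ := n * (n * B + B₀ + 1) with hC
  have hC0 : 0 ≤ C := by positivity
  have hn0 : (1 : ℝ) ≤ n := by exact_mod_cast (by omega : 1 ≤ n)
  -- Chosen so that the entrywise error `20 ε = 40 ρ C` of the derivative satisfies `n² · 20 ε ≤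
  -- 1/2`, as `closedBall_subset_image` requires.
  set ρ : ℝ := 1 / (80 * n ^ 2 * (C + 1)) with hρ
  have hρ0 : 0 < ρ := by positivity
  have hn2 : (1 : ℝ) ≤ n ^ 2 := one_le_pow₀ hn0
  have hρ4 : ρ ≤ 1 / 4 := by
    rw [hρ]
    apply one_div_le_one_div_of_le (by norm_num)
    nlinarith [mul_nonneg (sub_nonneg.2 hn2) hC0]
  have hρC : ρ * C ≤ 1 / (80 * n ^ 2) := by
    have : ρ * (C + 1) = 1 / (80 * n ^ 2) := by rw [hρ]; field_simp
    nlinarith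
  have hρn : 1 / (80 * (n : ℝ) ^ 2) ≤ 1 / 80 :=
    one_div_le_one_div_of_le (by norm_num) (by linarith)
  set ε := 2 * (ρ * C) with hε
  have hε2 : ε ≤ 1 / 2 := by linarith
  refine ⟨ρ / 2, by positivity, fun f hfam a ha y hy => ?_⟩
  obtain ⟨hbih, hf0, hf1, hS⟩ := hfam
  have hU := isOpen_polydisk n
  have hfd : ∀ z ∈ polydisk n, DifferentiableAt ℂ f z := fun z hz => hbih.differentiableAt hz
  have hf : ∀ l, DifferentiableOn ℂ (fun z => f z l) (polydisk n) := fun l z hz =>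
    (differentiableAt_apply (hfd z hz) l).differentiableWithinAt
  have hJ : ∀ z ∈ polydisk n, jac f z ≠ 0 := fun z hz => hbih.jac_ne_zero hz
  have h0U := zero_mem_polydisk (n := n)
  have hδ := pderiv_apply_of_fderiv_eq_id (hfd 0 h0U) hf1
  have hJ1 : jac f 0 = 1 := by rw [jac, jacMatrix_eq_one hδ, Matrix.det_one]
  have hL : ∀ i, logJac f i 0 = a i := fun i => by
    have h1 : pderiv i (jac f) 0 = ((n : ℂ) + 1) * a i := congrArg (fun x : Cn n => x i) ha
    have h2 : (n : ℂ) + 1 ≠ 0 := Nat.cast_add_one_ne_zero n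
    rw [logJac, hJ1, h1]
    field_simp
  set D : Cn n → ℂ := fun z => mobiusDenom a (f z) with hD
  have hDaff : IsAffineFor f D := isAffineFor_mobiusDenom a hf hJ
  have hD0 : D 0 = 1 := by simp only [hD, hf0, mobiusDenom_zero]
  -- The choice of `a` enters here: `∂_i D(0) = a_i = p_i(0)`, and `D(0) = 1`.
  have hDt : ∀ i, twistedDeriv f D i 0 = 0 := fun i => by
    rw [twistedDeriv, hD0, hL, pderiv_mobiusDenom a fun l => (hf l).differentiableAt
      (hU.mem_nhds h0U)]
    simp [hδ]
  have hft : ∀ l i, twistedDeriv f (fun z => f z l) i 0 = if l = i then 1 else 0 := fun l i => by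
    rw [twistedDeriv, hδ, hf0]; simp
  have hcoord : ∀ z ∈ closedBall (0 : Cn n) ρ, ∀ i, ‖z i‖ ≤ ρ := fun z hz i =>
    (PiLp.norm_apply_le z i).trans (mem_closedBall_zero_iff.1 hz)
  have hmem : closedBall (0 : Cn n) ρ ⊆ polydisk n := fun z hz i =>
    (hcoord z hz i).trans_lt (by linarith)
  have hite : ∀ l i : Fin n, ‖(if l = i then (1 : ℂ) else 0)‖ ≤ 1 := fun l i => by
    split_ifs <;> simp
  have hmain : ∀ z ∈ closedBall (0 : Cn n) ρ, D z ≠ 0 ∧ ∀ i l,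
      ‖pderiv i (fun w => mobius a (f w) l) z - if l = i then 1 else 0‖ ≤ 20 * ε := by
    intro z hz
    obtain ⟨w, hw, happ⟩ := exists_approx_initial_values hf hJ hB0 hB₀0
      (fun z hz => norm_schwarzian_le hα hf hS fun i => (hz i).trans (by norm_num))
      (fun z hz => norm_potential_le hn hα hf hJ hS hz) hρ0.le hρ4 (by linarith) (hcoord z hz)
    obtain ⟨hD1, hD2⟩ := happ D hDaff (by simp [hD0]) (fun i => by simp [hDt])
    rw [hD0] at hD1
    have hDz : D z ≠ 0 := fun h0 => by
      rw [h0, mul_zero, zero_sub, norm_neg, norm_one] at hD1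
      linarith
    refine ⟨hDz, fun i l => ?_⟩
    obtain ⟨hl1, hl2⟩ := happ _ (isAffineFor_apply hf hJ l) (by simp [hf0])
      (fun i => by rw [hft]; exact hite l i)
    have hl3 := hl2 i
    have hD3 := hD2 i
    rw [hft] at hl3
    rw [hDt, sub_zero] at hD3
    simp only [hf0, PiLp.zero_apply, sub_zero] at hl1
    have hz' := hU.mem_nhds (hmem hz)
    -- In the quotient rule the `p_i` terms of the two twisted derivatives cancel, and `w²` cancels
    -- between numerator and denominator.
    have e : pderiv i (fun w => mobius a (f w) l) z =
        (w * twistedDeriv f (fun z => f z l) i z * (w * D z) -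
          w * f z l * (w * twistedDeriv f D i z)) / (w * D z) ^ 2 := by
      simp only [mobius_apply]
      rw [pderiv_div ((hf l).differentiableAt hz') (hDaff.1.differentiableAt hz') hDz]
      simp only [twistedDeriv]
      field_simp
      ring
    rw [e]
    exact norm_quotient_derivative_sub_le hε2 (hite l i) hD1 hl3 hl1 hD3
  have hgd : ∀ z ∈ closedBall (0 : Cn n) ρ, DifferentiableAt ℂ (fun z => mobius a (f z)) z := by
    intro z hz
    have hz' := hU.mem_nhds (hmem hz)
    exact ((hDaff.1.differentiableAt hz').inv (hmain z hz).1).smul (hfd z (hmem hz))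
  obtain ⟨z, hz, hzy⟩ := closedBall_subset_image (η := 20 * ε) hρ0.le (by
      have h1 : (n : ℝ) * (n * (20 * ε)) = 40 * n ^ 2 * (ρ * C) := by rw [hε]; ring
      rw [h1]
      calc 40 * (n : ℝ) ^ 2 * (ρ * C) ≤ 40 * n ^ 2 * (1 / (80 * n ^ 2)) := by gcongr
        _ = 1 / 2 := by field_simp; norm_num)
    (by simp [mobius, hf0]) hgd (fun z hz => (hmain z hz).2) (ball_subset_closedBall hy)
  exact ⟨z, hmem hz, (hmain z hz).1, hzy⟩

theorem norm_sum_mul_le (a y : Cn n) : ‖∑ i, a i * y i‖ ≤ ‖a‖ * ‖y‖ := by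
  have h := norm_inner_le_norm (𝕜 := ℂ) (WithLp.toLp 2 fun i => star (a i) : Cn n) y
  have h1 : ‖(WithLp.toLp 2 fun i => star (a i) : Cn n)‖ = ‖a‖ := by
    simp [EuclideanSpace.norm_eq]
  rw [h1, PiLp.inner_apply] at h
  simpa [mul_comm (y _)] using h

/-- If the image of `T_a ∘ f` contains a ball of radius `s`, then `|a| ≤ 1 / s`. -/
theorem norm_le_of_covering {a : Cn n} {s : ℝ} (hs : 0 < s)
    (h : ∀ y ∈ ball (0 : Cn n) s, ∃ w : Cn n, mobiusDenom a w ≠ 0 ∧ mobius a w = y) :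
    ‖a‖ ≤ 1 / s := by
  by_contra! hlt
  have ha : 0 < ‖a‖ := lt_trans (by positivity) hlt
  -- The point of the omitted hyperplane `a·y = 1` nearest to the origin, of norm `1/‖a‖ < s`. It
  -- has no preimage, since `a·T_a(w) = 1 - 1/(1 + a·w)`.
  set y : Cn n := ((‖a‖ ^ 2 : ℝ) : ℂ)⁻¹ • WithLp.toLp 2 fun i => star (a i) with hy
  have hnorm : ‖(WithLp.toLp 2 fun i => star (a i) : Cn n)‖ = ‖a‖ := by
    simp [EuclideanSpace.norm_eq]
  have hys : y ∈ ball (0 : Cn n) s := by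
    rw [mem_ball_zero_iff, hy, norm_smul, hnorm, norm_inv, Complex.norm_real,
      Real.norm_of_nonneg (by positivity)]
    rw [div_lt_iff₀ hs] at hlt
    rw [inv_mul_lt_iff₀ (by positivity)]
    nlinarith
  have hay : ∑ i, a i * y i = 1 := by
    have h1 : ∑ i, a i * star (a i) = ((‖a‖ ^ 2 : ℝ) : ℂ) := by
      rw [EuclideanSpace.norm_sq_eq]
      push_cast
      exact Finset.sum_congr rfl fun i _ => by
        rw [Complex.star_def, Complex.mul_conj, Complex.normSq_eq_norm_sq]; push_cast; rfl
    have h2 : ∑ i, a i * y i = ((‖a‖ ^ 2 : ℝ) : ℂ)⁻¹ * ∑ i, a i * star (a i) := by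
      rw [Finset.mul_sum]
      refine Finset.sum_congr rfl fun i _ => ?_
      simp only [hy, PiLp.smul_apply, smul_eq_mul]
      ring
    rw [h2, h1]
    exact inv_mul_cancel₀ (Complex.ofReal_ne_zero.2 (by positivity))
  obtain ⟨w, hw, hwy⟩ := h y hys
  have h3 : ∑ i, a i * y i = (mobiusDenom a w - 1) / mobiusDenom a w := by
    rw [← hwy]
    simp only [mobius_apply, ← mul_div_assoc, ← Finset.sum_div]
    rw [mobiusDenom]
    ring
  rw [hay, eq_div_iff hw] at h3
  have h4 : (1 : ℂ) = 0 := by linear_combination h3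
  exact one_ne_zero h4

/-- Undoing the Möbius transform `T_a` on the ball of half the radius. -/
theorem exists_mobius_eq_imp {a : Cn n} {s : ℝ} (hs : 0 < s) (ha : ‖a‖ ≤ 1 / s) {y : Cn n}
    (hy : y ∈ ball (0 : Cn n) (s / 2)) :
    ∃ x ∈ ball (0 : Cn n) s, ∀ w : Cn n, mobiusDenom a w ≠ 0 → mobius a w = x → w = y := by
  rw [mem_ball_zero_iff] at hy
  set c : ℂ := ∑ i, a i * y i with hc
  have hc1 : ‖c‖ < 1 / 2 := by
    refine (norm_sum_mul_le a y).trans_lt ?_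
    rw [le_div_iff₀ hs] at ha
    nlinarith [norm_nonneg a, norm_nonneg y]
  have hc2 : 1 / 2 < ‖1 + c‖ := by
    have := norm_sub_norm_le (1 : ℂ) (-c)
    rw [norm_one, norm_neg, sub_neg_eq_add] at this
    linarith
  have hc0 : 1 + c ≠ 0 := fun h => by rw [h, norm_zero] at hc2; linarith
  -- The witness is `T_a(y)`, at most doubled in norm because `|1 + a·y| > 1/2`; injectivity of
  -- `T_a` then gives `w = y`.
  refine ⟨(1 + c)⁻¹ • y, ?_, fun w hw hwx => ?_⟩
  · rw [mem_ball_zero_iff, norm_smul, norm_inv, inv_mul_lt_iff₀ (by linarith)]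
    nlinarith
  · have hwi : ∀ i, w i = mobiusDenom a w * ((1 + c)⁻¹ * y i) := fun i => by
      have h1 := congrArg (fun x : Cn n => x i) hwx
      simp only [mobius_apply, PiLp.smul_apply, smul_eq_mul] at h1
      rw [← h1, mul_div_cancel₀ _ hw]
    have h2 : mobiusDenom a w = 1 + mobiusDenom a w * (1 + c)⁻¹ * c := by
      conv_lhs => rw [mobiusDenom]
      rw [hc, Finset.mul_sum]
      congr 1
      refine Finset.sum_congr rfl fun i _ => ?_
      conv_lhs => rw [hwi i]
      ring
    have h3 : mobiusDenom a w = 1 + c := by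
      field_simp at h2
      linear_combination h2
    ext i
    rw [hwi i, h3, ← mul_assoc, mul_inv_cancel₀ hc0, one_mul]

end Covering

end PolydiskSchwarzian

theorem theorem3p6 (n : ℕ) (hn : 2 ≤ n) (α : ℝ) (hα : 0 ≤ α) :
    ∃ s₀ : ℝ, 0 < s₀ ∧
      PolydiskSchwarzian.order n α ≤ ENNReal.ofReal (((n : ℝ) + 1) / s₀) ∧
      (∀ g ∈ PolydiskSchwarzian.normalizedFamily n α,
        Metric.ball (0 : PolydiskSchwarzian.Cn n) s₀ ⊆ g.ran) ∧
      (∀ f ∈ PolydiskSchwarzian.family n α,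
        Metric.ball (0 : PolydiskSchwarzian.Cn n) (s₀ / 2) ⊆
          f '' PolydiskSchwarzian.polydisk n) := by
  open PolydiskSchwarzian in
  obtain ⟨s, hs, hcov⟩ := exists_covering_radius hn hα
  have hn1 : (n : ℂ) + 1 ≠ 0 := Nat.cast_add_one_ne_zero n
  have hbound : ∀ f ∈ family n α, ∀ a : Cn n, grad (jac f) 0 = ((n : ℂ) + 1) • a →
      ‖a‖ ≤ 1 / s := fun f hf a ha => norm_le_of_covering hs fun y hy => by
    obtain ⟨z, -, h1, h2⟩ := hcov f hf a ha y hy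
    exact ⟨f z, h1, h2⟩
  have hexists : ∀ f : Cn n → Cn n, ∃ a : Cn n, grad (jac f) 0 = ((n : ℂ) + 1) • a := fun f =>
    ⟨((n : ℂ) + 1)⁻¹ • grad (jac f) 0, (smul_inv_smul₀ hn1 _).symm⟩
  refine ⟨s, hs, iSup₂_le fun f hf => ENNReal.ofReal_le_ofReal ?_, ?_, fun f hf y hy => ?_⟩
  · obtain ⟨a, ha⟩ := hexists f
    have h1 : ‖(n : ℂ) + 1‖ = (n : ℝ) + 1 := by
      rw [← Nat.cast_add_one, Complex.norm_natCast, Nat.cast_add_one]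
    rw [ha, norm_smul, h1, div_eq_mul_one_div]
    exact mul_le_mul_of_nonneg_left (hbound f hf a ha) (by positivity)
  · rintro g ⟨f, hf, a, ha, rfl⟩ y hy
    have hfd : ∀ z ∈ polydisk n, DifferentiableAt ℂ f z := fun z hz => hf.1.differentiableAt hz
    -- The normalization `∇J_g(0) = 0` becomes `∇J_f(0) = (n+1) a`, the hypothesis of the covering
    -- theorem.
    rw [grad_jac_mobius a (isOpen_polydisk n) zero_mem_polydisk
      (fun l z hz => (differentiableAt_apply (hfd z hz) l).differentiableWithinAt) hf.2.1
      (pderiv_apply_of_fderiv_eq_id (hfd 0 zero_mem_polydisk) hf.2.2.1), sub_eq_zero] at ha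
    obtain ⟨z, hz, h1, h2⟩ := hcov f hf a ha y hy
    exact ⟨z, (PFun.mem_res _ _ _ _).2 ⟨⟨hz, h1⟩, h2⟩⟩
  · obtain ⟨a, ha⟩ := hexists f
    obtain ⟨x, hx, hxy⟩ := exists_mobius_eq_imp hs (hbound f hf a ha) hy
    obtain ⟨z, hz, h1, h2⟩ := hcov f hf a ha x hx
    exact ⟨z, hz, hxy _ h1 h2⟩
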